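/- Let $X$ be a smooth, projective, geometrically irreducible curve over $\mathbb F_q$ with a point $\infty\in X(\mathbb F_q)$, $A=\mathcal O_X(X\setminus\{\infty\})$, $K=\operatorname{Frac}A$, $\Omega=\Omega_{A/\mathbb F_q}$ the module of Kähler differentials, $K_\infty$ the completion of $K$ at $\infty$ for the norm $\|x\|=q^{-v_\infty(x)}$, and $\mathbb C_\infty$ the completion of an algebraic closure of $K_\infty$. Let $\phi$ be a Drinfeld module of rank $r\ge 1$, i.e. a ring homomorphism $A\to\mathbb C_\infty[\tau]$ such that, for $0\neq a\in A$, $\phi_a$ has degree $r\deg a$ in the $q$-Frobenius $\tau$ and constant term $a$. Let $\Lambda\subset\mathbb C_\infty$ be its period lattice: the discrete, finitely generated $A$-submodule of rank $r$ such that $\phi_a(\exp_\Lambda(x))=\exp_\Lambda(ax)$ for all $a\in A$, where $\exp_\Lambda(x)=x\prod_{\lambda\in\Lambda\setminus\{0\}}(1-x/\lambda)$. For an $\mathbb F_q$-vector space $M$ let $\hat M=\operatorname{Hom}_{\mathbb F_q}(M,\mathbb F_q)$ with the topology of pointwise convergence, and let $\mathbb C_\infty\hat\otimes M$ be the space of continuous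 $\mathbb F_q$-linear maps $\hat M\to\mathbb C_\infty$; it contains $\mathbb C_\infty\otimes M$ via $c\otimes m\mapsto(\chi\mapsto\chi(m)c)$ (all tensor products are over $\mathbb F_q$), and its elements can be written as sums $\sum_i c_i\otimes m_i$ with $c_i\to0$. If $M$ is an $A$-module, $\mathbb C_\infty\hat\otimes M$ is a module over $\mathbb C_\infty\otimes A$, where $1\otimes a$ sends $f$ to $\chi\mapsto f(\chi(a\,\cdot))$. For $f\in\mathbb C_\infty\hat\otimes M$ and $j\geq0$, the Frobenius twist $f^{(j)}$ is $\chi\mapsto f(\chi)^{q^j}$, so that $(\sum_i c_i\otimes m_i)^{(j)}=\sum_i c_i^{q^j}\otimes m_i$. Let $\zeta_\phi=-\sum_{\lambda\in\Lambda\setminus\{0\}}\lambda^{-1}\otimes\lambda\in\mathbb C_\infty\hat\otimes\Lambda$ be the universal dual special function. Let $\omega_\phi\in\mathbb C_\infty\hat\otimes\operatorname{Hom}_A(\Lambda,\Omega)$ be the universal special function: identifying the Pontryagin dual of $\operatorname{Hom}_A(\Lambda,\Omega)$ with $K_\infty\Lambda/\Lambda$ through the residue pairing, in which the class of $b\lambda$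 ($b\in K_\infty$, $\lambda\in\Lambda$) is the functional $n\mapsto\operatorname{Res}_\infty(b\,n(\lambda))$, it is the function $c\mapsto\exp_\Lambda(c)$. Let $$ev:(\mathbb C_\infty\hat\otimes\Lambda)\otimes(\mathbb C_\infty\hat\otimes\operatorname{Hom}_A(\Lambda,\Omega))\to\mathbb C_\infty\hat\otimes\Omega,\qquad \Big(\sum_i c_i\otimes\lambda_i\Big)\otimes\Big(\sum_k d_k\otimes n_k\Big)\mapsto\sum_{i,k}c_id_k\otimes n_k(\lambda_i).$$ Then, for all integers $0\le j<r$, $ev(\zeta_\phi\otimes\omega_\phi^{(j)})$ is a rational differential form on $X_{\mathbb C_\infty}$, i.e. some nonzero-divisor of $\mathbb C_\infty\otimes A$ multiplies it into $\mathbb C_\infty\otimes\Omega$. Moreover, if $J\subseteq\mathbb C_\infty\otimes A$ is the ideal generated by the elements $a\otimes1-1\otimes a$, $a\in A$, then $J\cdot ev(\zeta_\phi\otimes\omega_\phi)\subseteq\mathbb C_\infty\otimes\Omega$, and $(\mathbb C_\infty\otimes A)\cdot ev(\zeta_\phi\otimes\omega_\phi^{(j)})\subseteq\mathbb C_\infty\otimes\Omega$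 for $1\le j\le r-1$. -/

import Mathlib

open scoped TensorProduct KaehlerDifferential

namespace DrinfeldPairing

noncomputable section

/-! ### The curve, the place at infinity, and the field `ℂ_∞` -/

/-- Let `K` be the fraction field of `A`.  The smooth projective curve `X` over `Fq` is given by its
function field `K`: the closed points of `X` are the nontrivial valuation rings of `K` containing
`Fq`.  The point `∞` is the valuation ring `O`, and `A = 𝒪_X(X ∖ {∞})` is the ring of all functions
regular at every point other than `∞`.  (`X` is geometrically irreducible because it has the
`Fq`-rational point `∞`.) -/
structure IsRingOfFunctionsAwayFrom (Fq A : Type*) {K : Type*} [Field Fq] [CommRing A] [Field K]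
    [Algebra Fq K] [Algebra A K] (O : ValuationSubring K) : Prop where
  /-- `K` is a finitely generated field extension of `Fq` ... -/
  fg : (⊤ : IntermediateField Fq K).FG
  /-- ... of transcendence degree one. -/
  trdeg_eq_one : Algebra.trdeg Fq K = 1
  /-- `O` is a valuation ring of `K / Fq` ... -/
  algebraMap_mem : ∀ c : Fq, algebraMap Fq K c ∈ O
  /-- ... which is not trivial ... -/
  ne_top : O ≠ ⊤
  /-- ... and whose residue field is `Fq`. -/
  degree_one : ∀ x ∈ O, ∃ c : Fq, x - algebraMap Fq K c ∈ O.nonunits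
  /-- `A` consists of the functions that are regular away from `∞`. -/
  mem_range_iff : ∀ x : K, x ∈ Set.range (algebraMap A K) ↔
    ∀ V : ValuationSubring K, (∀ c : Fq, algebraMap Fq K c ∈ V) → V ≠ O → x ∈ V

/-- The completion `K_∞` of `K`, realised as the closure of `K` in `C = ℂ_∞`. -/
def kInfty (K C : Type*) [Field K] [NormedField C] [Algebra K C] : Subfield C :=
  (algebraMap K C).fieldRange.topologicalClosure

/-- The (complete, nonarchimedean) normed field `C` is `ℂ_∞`: its norm restricts to the normalized `∞`-adic norm
`‖x‖ = q ^ (-v_∞(x))` on `K`, and `C` is the completion of an algebraic closure of `K_∞`. -/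
structure IsCInfty (Fq : Type*) {K : Type*} (C : Type*) [Field Fq] [Fintype Fq] [Field K]
    [NormedField C] [CompleteSpace C] [Algebra K C] (O : ValuationSubring K) : Prop where
  norm_le_one_iff : ∀ x : K, ‖algebraMap K C x‖ ≤ 1 ↔ x ∈ O
  norm_eq_zpow : ∀ x : K, x ≠ 0 → ∃ n : ℤ, ‖algebraMap K C x‖ = (Fintype.card Fq : ℝ) ^ n
  exists_uniformizer : ∃ x : K, ‖algebraMap K C x‖ = (Fintype.card Fq : ℝ)⁻¹
  isAlgClosure : IsAlgClosure (kInfty K C) (algebraicClosure (kInfty K C) C)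
  dense : Dense (algebraicClosure (kInfty K C) C : Set C)

/-! ### Drinfeld modules and their period lattices -/

/-- `φ : A → C[τ] ⊆ End_{Fq}(C)` is a Drinfeld module of rank `r`: for `a ≠ 0`, of degree `d`
(that is, `‖a‖ = q ^ d`), `φ_a` is a polynomial of degree `r * d` in the Frobenius `τ` with
constant term `a`. -/
def IsDrinfeldModule {Fq A C : Type*} [Field Fq] [Fintype Fq] [CommRing A] [NormedField C]
    [Algebra Fq C] [Algebra A C] (φ : A →+* Module.End Fq C) (r : ℕ) : Prop :=
  ∀ a : A, a ≠ 0 → ∃ d : ℕ, ‖algebraMap A C a‖ = (Fintype.card Fq : ℝ) ^ d ∧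
    ∃ c : ℕ → C,
      (∀ x : C, φ a x = ∑ i ∈ Finset.range (r * d + 1), c i * x ^ (Fintype.card Fq ^ i)) ∧
      c 0 = algebraMap A C a ∧ c (r * d) ≠ 0

/-- The exponential function `exp_Λ(x) = x ∏_{λ ∈ Λ ∖ {0}} (1 - x / λ)`. -/
def latticeExp {A C : Type*} [CommRing A] [NormedField C] [Algebra A C] (Λ : Submodule A C)
    (x : C) : C :=
  x * ∏' l : {l : Λ // l ≠ 0}, (1 - x / (l.1 : C))

/-- A subset of `C` is locally finite if it has finitely many elements in each ball. -/
def IsLocallyFinite {A C : Type*} [CommRing A] [NormedField C] [Algebra A C]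
    (Λ : Submodule A C) : Prop :=
  ∀ R : ℝ, {x : C | x ∈ Λ ∧ ‖x‖ ≤ R}.Finite

/-- `Λ` is the period lattice of the Drinfeld module `φ` of rank `r`: a finitely generated discrete
`A`-submodule of `C` of rank `r` with `φ_a (exp_Λ x) = exp_Λ (a x)`. -/
structure IsPeriodLattice {Fq A C : Type*} [Field Fq] [CommRing A] [NormedField C]
    [Algebra Fq C] [Algebra A C] (φ : A →+* Module.End Fq C) (r : ℕ) (Λ : Submodule A C) :
    Prop where
  fg : Λ.FG
  finrank_eq : Module.finrank A Λ = r
  locallyFinite : IsLocallyFinite Λ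
  map_exp : ∀ (a : A) (x : C), φ a (latticeExp Λ x) = latticeExp Λ (algebraMap A C a * x)

/-! ### Pontryagin duals and completed tensor products -/

section Completed

variable (Fq C M : Type*) [Field Fq] [NormedField C] [Algebra Fq C] [AddCommGroup M] [Module Fq M]

/-- The topology of the Pontryagin dual `Hom_{Fq}(M, Fq)` of the discrete `Fq`-vector space `M`:
pointwise convergence, `Fq` being discrete. -/
@[reducible]
def dualTopology : TopologicalSpace (Module.Dual Fq M) :=
  TopologicalSpace.induced (fun χ m => χ m) (@Pi.topologicalSpace M (fun _ => Fq) fun _ => ⊥)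

variable {Fq C M}

theorem continuous_dual_iff (f : Module.Dual Fq M →ₗ[Fq] C) :
    @Continuous _ _ (dualTopology Fq M) _ f ↔
      ∀ ε > 0, ∃ S : Finset M, ∀ χ : Module.Dual Fq M, (∀ m ∈ S, χ m = 0) → ‖f χ‖ < ε := by
  let _ : TopologicalSpace Fq := ⊥
  have : DiscreteTopology Fq := ⟨rfl⟩
  let _ : TopologicalSpace (Module.Dual Fq M) := dualTopology Fq M
  have key : ∀ (χ₀ : Module.Dual Fq M) (s : Set (Module.Dual Fq M)), s ∈ nhds χ₀ ↔
      ∃ S : Finset M, ∀ χ : Module.Dual Fq M, (∀ m ∈ S, χ m = χ₀ m) → χ ∈ s := by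
    intro χ₀ s
    have : nhds χ₀ = Filter.comap (fun (χ : Module.Dual Fq M) (m : M) => χ m)
        (nhds (fun m => χ₀ m)) := nhds_induced _ _
    rw [this, Filter.mem_comap]
    constructor
    · rintro ⟨t, ht, hts⟩
      rw [nhds_pi, Filter.mem_pi'] at ht
      obtain ⟨S, u, hu, hut⟩ := ht
      refine ⟨S, fun χ hχ => hts (hut fun m hm => ?_)⟩
      change χ m ∈ u m
      rw [hχ m hm]
      exact mem_of_mem_nhds (hu m)
    · rintro ⟨S, hS⟩
      refine ⟨(S : Set M).pi fun m => {χ₀ m}, set_pi_mem_nhds S.finite_toSet fun m _ => by simp, ?_⟩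
      intro χ hχ
      exact hS χ fun m hm => hχ m hm
  constructor
  · intro hf ε hε
    have h0 : f ⁻¹' Metric.ball 0 ε ∈ nhds (0 : Module.Dual Fq M) :=
      hf.continuousAt.preimage_mem_nhds (by rw [map_zero]; exact Metric.ball_mem_nhds _ hε)
    obtain ⟨S, hS⟩ := (key _ _).1 h0
    refine ⟨S, fun χ hχ => ?_⟩
    simpa using hS χ (by simpa using hχ)
  · intro h
    rw [continuous_iff_continuousAt]
    intro χ₀
    rw [ContinuousAt, Metric.tendsto_nhds]
    intro ε hε
    obtain ⟨S, hS⟩ := h ε hε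
    refine (key _ _).2 ⟨S, fun χ hχ => ?_⟩
    have := hS (χ - χ₀) fun m hm => by simp [hχ m hm]
    simpa [dist_eq_norm] using this

variable (Fq C M)

/-- The completed tensor product `C ⊗̂ M := Hom_{Fq}^{cont}(Hom_{Fq}(M, Fq), C)` for a discrete
`Fq`-vector space `M`. -/
def CTensor : Submodule C (Module.Dual Fq M →ₗ[Fq] C) where
  carrier := {f | @Continuous _ _ (dualTopology Fq M) _ f}
  add_mem' {f g} hf hg := by
    let _ : TopologicalSpace (Module.Dual Fq M) := dualTopology Fq M
    exact Continuous.add (f := fun χ => f χ) (g := fun χ => g χ) hf hg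
  zero_mem' := by
    let _ : TopologicalSpace (Module.Dual Fq M) := dualTopology Fq M
    exact continuous_const (y := (0 : C))
  smul_mem' c f hf := by
    let _ : TopologicalSpace (Module.Dual Fq M) := dualTopology Fq M
    exact Continuous.mul (f := fun _ => c) (g := fun χ => f χ) continuous_const hf

variable {Fq C M}

theorem mem_CTensor_iff (f : Module.Dual Fq M →ₗ[Fq] C) : f ∈ CTensor Fq C M ↔
    ∀ ε > 0, ∃ S : Finset M, ∀ χ : Module.Dual Fq M, (∀ m ∈ S, χ m = 0) → ‖f χ‖ < ε :=
  continuous_dual_iff f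

theorem CTensor.tendsto_coord {ι : Type*} (z : CTensor Fq C M)
    (b : Module.Basis ι Fq M) :
    Filter.Tendsto (fun i => z.1 (b.coord i)) Filter.cofinite (nhds 0) := by
  classical
  rw [Metric.tendsto_nhds]
  intro ε hε
  obtain ⟨S, hS⟩ := (mem_CTensor_iff _).1 z.2 ε hε
  rw [Filter.eventually_cofinite]
  refine (S.biUnion fun m => (b.repr m).support).finite_toSet.subset fun i hi => ?_
  by_contra hcon
  refine hi ?_
  rw [dist_zero_right]
  refine hS _ fun m hm => ?_
  simp only [Finset.mem_coe, Finset.mem_biUnion, not_exists, not_and] at hcon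
  simpa using hcon m hm

variable (Fq C M)

/-- The canonical map `C ⊗ M → C ⊗̂ M`, sending `c ⊗ m` to `χ ↦ χ(m) c`. -/
def ofTensor : C ⊗[Fq] M →ₗ[Fq] CTensor Fq C M :=
  TensorProduct.lift
    { toFun := fun c =>
        { toFun := fun m => ⟨(Module.Dual.eval Fq M m).smulRight c, by
            rw [mem_CTensor_iff]
            intro ε hε
            exact ⟨{m}, fun χ hχ => by simpa [hχ m (by simp)] using hε⟩⟩
          map_add' := fun m n => by ext χ; simp [add_smul]
          map_smul' := fun k m => by ext χ; simp [mul_smul] }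
      map_add' := fun c d => by ext m χ; simp
      map_smul' := fun k c => by ext m χ; simp [smul_comm k] }

variable (A : Type*) [CommRing A] [Algebra Fq A] [Module A M] [IsScalarTower Fq A M]

variable {Fq C M A} in
/-- The action of `1 ⊗ a` on `C ⊗̂ M`: `((1 ⊗ a) f)(χ) = f (m ↦ χ (a m))`. -/
def rightMul (a : A) (f : CTensor Fq C M) : CTensor Fq C M :=
  ⟨f.1 ∘ₗ (Algebra.lsmul Fq Fq M a).dualMap, by
    classical
    rw [mem_CTensor_iff]
    intro ε hε
    obtain ⟨S, hS⟩ := (mem_CTensor_iff _).1 f.2 ε hε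
    refine ⟨S.image (a • ·), fun χ hχ => hS _ fun m hm => ?_⟩
    exact hχ _ (Finset.mem_image_of_mem _ hm)⟩

variable {Fq C M A} in
/-- The map `h ↦ h f` from `C ⊗ A` to `C ⊗̂ M`, for `f ∈ C ⊗̂ M`, with
`(c ⊗ a) f = c ((1 ⊗ a) f)`. -/
def tensorSMulHom (f : CTensor Fq C M) : C ⊗[Fq] A →ₗ[Fq] CTensor Fq C M :=
  TensorProduct.lift
    { toFun := fun c =>
        { toFun := fun a => c • rightMul a f
          map_add' := fun a b => by
            rw [← smul_add]
            refine congrArg (c • ·) (Subtype.ext (LinearMap.ext fun χ => ?_))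
            refine (congrArg f.1 (LinearMap.ext fun m => ?_)).trans (map_add f.1 _ _)
            simp
          map_smul' := fun k a => by
            rw [RingHom.id_apply, smul_comm k c]
            refine congrArg (c • ·) (Subtype.ext (LinearMap.ext fun χ => ?_))
            refine (congrArg f.1 (LinearMap.ext fun m => ?_)).trans (map_smul f.1 k _)
            simp }
      map_add' := fun c d => LinearMap.ext fun a => add_smul c d _
      map_smul' := fun k c => LinearMap.ext fun a => smul_assoc k c _ }

/-- The action of `C ⊗ A` on `C ⊗̂ M`, for an `A`-module `M`. -/
def tensorAction (h : C ⊗[Fq] A) (f : CTensor Fq C M) : CTensor Fq C M :=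
  tensorSMulHom f h

theorem tensorAction_tmul (c : C) (a : A) (f : CTensor Fq C M) (χ : Module.Dual Fq M) :
    (tensorAction Fq C M A (c ⊗ₜ a) f).1 χ = c * f.1 (χ ∘ₗ Algebra.lsmul Fq Fq M a) :=
  rfl

variable {Fq C M}

/-- An element of `C ⊗̂ M` is rational if it becomes an element of `C ⊗ M` after multiplication by
some nonzerodivisor of `C ⊗ A`, i.e. if it lies in `Frac(C ⊗ A) ⊗ M`.  For `M = Ω` these are the
rational differential forms on `X_C`. -/
def IsRational (η : CTensor Fq C M) : Prop :=
  ∃ h ∈ nonZeroDivisors (C ⊗[Fq] A), tensorAction Fq C M A h η ∈ LinearMap.range (ofTensor Fq C M)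

variable (Fq C) in
/-- The ideal `J` of `C ⊗ A` generated by the elements `a ⊗ 1 - 1 ⊗ a`. -/
def diagonalIdeal [Algebra A C] : Ideal (C ⊗[Fq] A) :=
  Ideal.span (Set.range fun a : A => algebraMap A C a ⊗ₜ[Fq] (1 : A) - (1 : C) ⊗ₜ[Fq] a)

/-- The Frobenius twist `f ↦ f^{(j)}` on `C ⊗̂ M`, sending `∑ c_i ⊗ m_i` to
`∑ c_i ^ (q ^ j) ⊗ m_i`; equivalently `f^{(j)}(χ) = f(χ) ^ (q ^ j)`. -/
def twist [Fintype Fq] (j : ℕ) (f : CTensor Fq C M) : CTensor Fq C M :=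
  ⟨((FiniteField.frobeniusAlgHom Fq C) ^ j).toLinearMap ∘ₗ f.1, by
    let _ : TopologicalSpace (Module.Dual Fq M) := dualTopology Fq M
    have hf : Continuous fun χ => f.1 χ := f.2
    have : (fun χ => (((FiniteField.frobeniusAlgHom Fq C) ^ j).toLinearMap ∘ₗ f.1) χ) =
        fun χ => f.1 χ ^ Fintype.card Fq ^ j := by
      funext χ
      simp [AlgHom.coe_pow, FiniteField.coe_frobeniusAlgHom, pow_iterate]
    change Continuous fun χ => (((FiniteField.frobeniusAlgHom Fq C) ^ j).toLinearMap ∘ₗ f.1) χ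
    rw [this]
    exact hf.pow _⟩

end Completed

/-! ### The pairing `ev` -/

section Pairing

variable {Fq C : Type*} [Field Fq] [Fintype Fq] [NormedField C] [Algebra Fq C]

theorem norm_algebraMap_le_one (k : Fq) : ‖algebraMap Fq C k‖ ≤ 1 := by
  rcases eq_or_ne k 0 with rfl | hk
  · simp
  · refine (IsOfFinOrder.norm_eq_one ?_).le
    have h : IsOfFinOrder (Units.mk0 k hk) := isOfFinOrder_of_finite _
    exact ((algebraMap Fq C).toMonoidHom.isOfFinOrder
      ((Units.coeHom Fq).isOfFinOrder h) :)

theorem norm_smul_le' (k : Fq) (c : C) : ‖k • c‖ ≤ ‖c‖ := by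
  rw [Algebra.smul_def, norm_mul]
  exact mul_le_of_le_one_left (norm_nonneg _) (norm_algebraMap_le_one k)

theorem CTensor.exists_bound {M : Type*} [AddCommGroup M] [Module Fq M] (w : CTensor Fq C M) :
    ∃ B > 0, ∀ χ, ‖w.1 χ‖ ≤ B := by
  classical
  obtain ⟨S, hS⟩ := (mem_CTensor_iff _).1 w.2 1 one_pos
  let g : Module.Dual Fq M → (S → Fq) := fun χ m => χ m
  let e : (S → Fq) → Module.Dual Fq M := fun u => if h : ∃ χ, g χ = u then h.choose else 0
  have he : ∀ χ, g (e (g χ)) = g χ := fun χ => by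
    have h : ∃ χ', g χ' = g χ := ⟨χ, rfl⟩
    simp only [e, dif_pos h]
    exact h.choose_spec
  refine ⟨1 + ∑ u, ‖w.1 (e u)‖, by positivity, fun χ => ?_⟩
  have h1 : ‖w.1 (χ - e (g χ))‖ < 1 := hS _ fun m hm => by
    have := congrFun (he χ) ⟨m, hm⟩
    simp only [g] at this
    simp [this, g]
  have h2 : ‖w.1 (e (g χ))‖ ≤ ∑ u, ‖w.1 (e u)‖ :=
    Finset.single_le_sum (f := fun u => ‖w.1 (e u)‖) (fun _ _ => norm_nonneg _)
      (Finset.mem_univ _)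
  calc ‖w.1 χ‖ = ‖w.1 (χ - e (g χ)) + w.1 (e (g χ))‖ := by rw [← map_add, sub_add_cancel]
    _ ≤ _ := (norm_add_le _ _).trans (add_le_add h1.le h2)

variable [CompleteSpace C] [IsUltrametricDist C]
  {A L P : Type*} [CommRing A] [Algebra Fq A]
  [AddCommGroup L] [Module A L] [Module Fq L]
  [AddCommGroup P] [Module A P] [Module Fq P] [IsScalarTower Fq A P]

/-- For `l ∈ L`, the map `Hom_{Fq}(P, Fq) → Hom_{Fq}(Hom_A(L, P), Fq)` sending `χ` to
`n ↦ χ (n l)`. -/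
def dualEval (l : L) : Module.Dual Fq P →ₗ[Fq] Module.Dual Fq (L →ₗ[A] P) :=
  LinearMap.dualMap
    { toFun := fun n : L →ₗ[A] P => n l
      map_add' := fun _ _ => rfl
      map_smul' := fun _ _ => rfl }

theorem ev_tendsto (z : CTensor Fq C L) (w : CTensor Fq C (L →ₗ[A] P)) {ι : Type*}
    (b : Module.Basis ι Fq L) (χ : Module.Dual Fq P) :
    Filter.Tendsto (fun i => z.1 (b.coord i) * w.1 (dualEval (b i) χ)) Filter.cofinite
      (nhds 0) := by
  obtain ⟨B, hB, hw⟩ := CTensor.exists_bound w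
  refine squeeze_zero_norm (a := fun i => ‖z.1 (b.coord i)‖ * B) (fun i => ?_) ?_
  · rw [norm_mul]
    exact mul_le_mul_of_nonneg_left (hw _) (norm_nonneg _)
  · simpa using (CTensor.tendsto_coord z b).norm.mul_const B

theorem ev_summable (z : CTensor Fq C L) (w : CTensor Fq C (L →ₗ[A] P)) {ι : Type*}
    (b : Module.Basis ι Fq L) (χ : Module.Dual Fq P) :
    Summable (fun i => z.1 (b.coord i) * w.1 (dualEval (b i) χ)) :=
  NonarchimedeanAddGroup.summable_of_tendsto_cofinite_zero (ev_tendsto z w b χ)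

/-- The evaluation pairing `ev : (C ⊗̂ L) × (C ⊗̂ Hom_A(L, P)) → C ⊗̂ P`.  Writing
`z = ∑ c_i ⊗ l_i` for an `Fq`-basis `(l_i)` of `L` (so that `c_i = z(l_i^*)` tends to zero) and
`w = ∑ d_k ⊗ n_k`, it is `ev(z ⊗ w) = ∑ c_i d_k ⊗ n_k(l_i)`, i.e.
`ev(z ⊗ w)(χ) = ∑ c_i w(n ↦ χ(n(l_i)))`. -/
def ev (z : CTensor Fq C L) (w : CTensor Fq C (L →ₗ[A] P)) : CTensor Fq C P :=
  let b := Module.Basis.ofVectorSpace Fq L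
  ⟨{ toFun := fun χ => ∑' i, z.1 (b.coord i) * w.1 (dualEval (b i) χ)
     map_add' := fun χ ψ => by
      rw [← (ev_summable z w b χ).tsum_add (ev_summable z w b ψ)]
      simp [mul_add]
     map_smul' := fun k χ => by
      simp only [map_smul, RingHom.id_apply, mul_smul_comm]
      simp only [Algebra.smul_def]
      rw [tsum_mul_left] }, by
    classical
    rw [mem_CTensor_iff]
    intro ε hε
    obtain ⟨B, hB, hw⟩ := CTensor.exists_bound w
    have hz := (Metric.tendsto_nhds.1 (CTensor.tendsto_coord z b)) (ε / 2 / B) (by positivity)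
    rw [Filter.eventually_cofinite] at hz
    have hS : ∀ i, ∃ S : Finset P, ∀ χ : Module.Dual Fq P, (∀ m ∈ S, χ m = 0) →
        ‖z.1 (b.coord i) * w.1 (dualEval (b i) χ)‖ ≤ ε / 2 := fun i => by
      obtain ⟨T, hT⟩ := (mem_CTensor_iff _).1 w.2 (ε / 2 / (‖z.1 (b.coord i)‖ + 1))
        (by positivity)
      refine ⟨T.image fun n => n (b i), fun χ hχ => ?_⟩
      have h := hT (dualEval (b i) χ) fun n hn => hχ _ (Finset.mem_image_of_mem _ hn)
      rw [norm_mul]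
      calc ‖z.1 (b.coord i)‖ * ‖w.1 (dualEval (b i) χ)‖
          ≤ (‖z.1 (b.coord i)‖ + 1) * (ε / 2 / (‖z.1 (b.coord i)‖ + 1)) := by
            gcongr
            linarith
        _ = ε / 2 := by field_simp
    choose S hS using hS
    refine ⟨hz.toFinset.biUnion S, fun χ hχ => ?_⟩
    refine lt_of_le_of_lt ?_ (half_lt_self hε)
    refine (IsUltrametricDist.norm_tsum_le _).trans (Real.iSup_le (fun i => ?_) (by positivity))
    by_cases hi : i ∈ hz.toFinset
    · exact hS i χ fun m hm => hχ m (Finset.mem_biUnion.2 ⟨i, hi, hm⟩)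
    · have hi' : ‖z.1 (b.coord i)‖ < ε / 2 / B := by simpa using hi
      rw [norm_mul]
      calc ‖z.1 (b.coord i)‖ * ‖w.1 (dualEval (b i) χ)‖ ≤ (ε / 2 / B) * B := by
            gcongr
            exact hw _
        _ = ε / 2 := by field_simp⟩

end Pairing

/-! ### The universal dual special function -/

section Zeta

theorem tendsto_inv_lattice {A C : Type*} [CommRing A] [NormedField C] [Algebra A C]
    {Λ : Submodule A C} (hΛ : IsLocallyFinite Λ) :
    Filter.Tendsto (fun l : {l : Λ // l ≠ 0} => ((l.1 : C))⁻¹) Filter.cofinite (nhds 0) := by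
  rw [Metric.tendsto_nhds]
  intro ε hε
  rw [Filter.eventually_cofinite]
  have hinj : Function.Injective fun l : {l : Λ // l ≠ 0} => (l.1 : C) :=
    Subtype.val_injective.comp Subtype.val_injective
  refine ((hΛ ε⁻¹).preimage hinj.injOn).subset fun l hl => ⟨l.1.2, ?_⟩
  have h : ε ≤ ‖(l.1 : C)‖⁻¹ := by simpa using hl
  exact (le_inv_comm₀ hε ((lt_of_lt_of_le hε h).trans_le le_rfl |> inv_pos.1)).1 h

variable {Fq A C : Type*} [Field Fq] [Fintype Fq] [CommRing A] [NormedField C] [CompleteSpace C]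
  [IsUltrametricDist C] [Algebra Fq A] [Algebra Fq C] [Algebra A C] [IsScalarTower Fq A C]

theorem zeta_summable {Λ : Submodule A C} (hΛ : IsLocallyFinite Λ) (χ : Module.Dual Fq Λ) :
    Summable fun l : {l : Λ // l ≠ 0} => χ l.1 • ((l.1 : C))⁻¹ := by
  refine NonarchimedeanAddGroup.summable_of_tendsto_cofinite_zero ?_
  refine squeeze_zero_norm (fun l => norm_smul_le' _ _) ?_
  simpa using (tendsto_inv_lattice hΛ).norm

variable (Fq) in
/-- The universal dual special function `ζ_φ = -∑_{λ ∈ Λ ∖ {0}} λ⁻¹ ⊗ λ ∈ C ⊗̂ Λ`, i.e. the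
continuous map `χ ↦ -∑_{λ ∈ Λ ∖ {0}} χ(λ) λ⁻¹`. -/
def universalZeta (Λ : Submodule A C) (hΛ : IsLocallyFinite Λ) : CTensor Fq C Λ :=
  ⟨{ toFun := fun χ => -∑' l : {l : Λ // l ≠ 0}, χ l.1 • ((l.1 : C))⁻¹
     map_add' := fun χ ψ => by
      rw [← neg_add, ← (zeta_summable hΛ χ).tsum_add (zeta_summable hΛ ψ)]
      simp [add_smul]
     map_smul' := fun k χ => by
      simp only [LinearMap.smul_apply, smul_eq_mul, mul_smul, RingHom.id_apply, smul_neg]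
      simp only [Algebra.smul_def k]
      rw [tsum_mul_left] }, by
    classical
    rw [mem_CTensor_iff]
    intro ε hε
    have hz := (Metric.tendsto_nhds.1 (tendsto_inv_lattice hΛ)) (ε / 2) (by positivity)
    rw [Filter.eventually_cofinite] at hz
    refine ⟨hz.toFinset.image Subtype.val, fun χ hχ => ?_⟩
    refine lt_of_le_of_lt ?_ (half_lt_self hε)
    simp only [LinearMap.coe_mk, AddHom.coe_mk, norm_neg]
    refine (IsUltrametricDist.norm_tsum_le _).trans (Real.iSup_le (fun l => ?_) (by positivity))
    by_cases hl : l ∈ hz.toFinset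
    · rw [hχ _ (Finset.mem_image_of_mem _ hl), zero_smul, norm_zero]
      positivity
    · have hl' : ‖((l.1 : C))⁻¹‖ < ε / 2 := by simpa using hl
      exact (norm_smul_le' _ _).trans hl'.le⟩

end Zeta

/-! ### Residues at infinity and the universal special function -/

section Omega

variable {Fq A K C : Type*} [Field Fq] [Fintype Fq] [CommRing A] [Field K] [NormedField C]
  [Algebra Fq A] [Algebra Fq K] [Algebra Fq C] [Algebra A K] [Algebra A C] [Algebra K C]
  [IsScalarTower Fq A K] [IsScalarTower Fq A C]

/-- `x` is the residue at `∞` of the differential form `b η`, where `b ∈ K_∞` and `η ∈ Ω`: writing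
`η = h dπ` with `h ∈ K` and expanding `b h = ∑_n c_n π ^ n` in `K_∞ = Fq((π))`, it is `c_{-1}`.
Here `π ∈ K` is a uniformizer at `∞`. -/
def IsResidue (π : K) (b : C) (η : Ω[A⁄Fq]) (x : Fq) : Prop :=
  ∃ h : K, KaehlerDifferential.map Fq Fq A K η = h • KaehlerDifferential.D Fq K π ∧
    ∃ c : ℤ → Fq, HasSum (fun n : ℤ => c n • (algebraMap K C π) ^ n) (b * algebraMap K C h) ∧
      c (-1) = x

variable (Fq) in
/-- `w ∈ C ⊗̂ Hom_A(Λ, Ω)` corresponds to `exp_Λ`.  The Pontryagin dual of `Hom_A(Λ, Ω)` is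
`K_∞ Λ / Λ`, the class of `b λ` (for `b ∈ K_∞` and `λ ∈ Λ`) being the functional
`n ↦ Res_∞(b n(λ))`; the condition says that `w`, as a function on this dual, is
`c ↦ exp_Λ(c)`. As these classes generate the dual, at most one `w` has this property. -/
def IsExponential (π : K) (Λ : Submodule A C) (w : CTensor Fq C (Λ →ₗ[A] Ω[A⁄Fq])) : Prop :=
  ∀ b ∈ kInfty K C, ∀ (l : Λ) (χ : Module.Dual Fq (Λ →ₗ[A] Ω[A⁄Fq])),
    (∀ n, IsResidue π b (n l) (χ n)) → w.1 χ = latticeExp Λ (b * l)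

open Classical in
variable (Fq) in
/-- The universal special function `ω_φ ∈ C ⊗̂ Hom_A(Λ, Ω)`: the element which, as a function on
the Pontryagin dual `K_∞ Λ / Λ` of `Hom_A(Λ, Ω)`, is the exponential function `exp_Λ`. -/
def universalOmega (π : K) (Λ : Submodule A C) : CTensor Fq C (Λ →ₗ[A] Ω[A⁄Fq]) :=
  if h : ∃ w, IsExponential Fq π Λ w then h.choose else 0

end Omega

end

end DrinfeldPairing

/-!
For `b ∈ K_∞` close to zero, `∑_{λ ≠ 0} exp_Λ(b λ)^(q^j) / λ` equals `-b` if `j = 0` and vanishes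
if `j > 0`. To see this, replace `exp_Λ` by the polynomial `x ∏ (1 - x / λ)` over the lattice points
of norm at most `R` and the sum by the sum of `G(λ) / λ` over the larger finite group `V` of lattice
points of norm at most `c R`, where `G` has no constant term. The sum of `λ^n` over `λ ≠ 0` in an
additive group `V` is `0` for `0 < n < |V| - 1`, so for `G` of degree below `|V|` only the linear
coefficient of `G` contributes.

An element of `C ⊗̂ Ω` lies in `C ⊗ Ω` exactly when it vanishes on all functionals that are zero on
some finite subset of `Ω`. A functional that is zero on a large finite subset is, by duality, the
residue pairing with a small `b ∈ K_∞`, and at such a functional the value of `ev(ζ ⊗ ω^(j))` is `b`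
or `0` by the computation above. This gives the claim for `j > 0`. For `j = 0` the action of
`a ⊗ 1 - 1 ⊗ a` turns `b ↦ b` into `b ↦ a b - a b = 0`, and `a ⊗ 1 - 1 ⊗ a` is a nonzero divisor for
nonconstant `a`.
-/

namespace DrinfeldPairing

theorem exists_forall_notMem_norm_le {E ι : Type*} [SeminormedAddCommGroup E] {u : ι → E}
    (hu : Filter.Tendsto u Filter.cofinite (nhds 0)) {δ : ℝ} (hδ : 0 < δ) :
    ∃ S : Finset ι, ∀ i ∉ S, ‖u i‖ ≤ δ := by
  have hev := (Metric.tendsto_nhds.1 hu) δ hδ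
  rw [Filter.eventually_cofinite] at hev
  exact ⟨hev.toFinset, fun i hi => by simpa using (not_not.1 (hev.mem_toFinset.not.1 hi)).le⟩

section Ultrametric

variable {E ι : Type*} [NormedAddCommGroup E] [IsUltrametricDist E]

theorem norm_add_le_of_norm_le {x y : E} {δ : ℝ} (hx : ‖x‖ ≤ δ) (hy : ‖y‖ ≤ δ) : ‖x + y‖ ≤ δ :=
  (IsUltrametricDist.norm_add_le_max x y).trans (max_le hx hy)

theorem norm_sub_le_of_norm_le {x y : E} {δ : ℝ} (hx : ‖x‖ ≤ δ) (hy : ‖y‖ ≤ δ) : ‖x - y‖ ≤ δ := by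
  rw [sub_eq_add_neg]
  exact norm_add_le_of_norm_le hx (by rwa [norm_neg])

theorem norm_eq_of_norm_sub_lt {x y : E} (h : ‖x - y‖ < ‖y‖) : ‖x‖ = ‖y‖ := by
  rw [← norm_neg y] at h ⊢
  rw [sub_eq_add_neg] at h
  exact IsUltrametricDist.norm_eq_of_add_norm_lt_max (lt_max_of_lt_right h)

theorem norm_tsum_sub_sum_le {f : ι → E} (hf : Summable f) (S : Finset ι) {δ : ℝ} (hδ : 0 ≤ δ)
    (h : ∀ i ∉ S, ‖f i‖ ≤ δ) : ‖∑' i, f i - ∑ i ∈ S, f i‖ ≤ δ := by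
  classical
  refine le_of_tendsto (hf.hasSum.sub_const _).norm ?_
  filter_upwards [Filter.eventually_ge_atTop S] with T hST
  rw [← Finset.sum_sdiff hST, add_sub_cancel_right]
  exact IsUltrametricDist.norm_sum_le_of_forall_le_of_nonneg hδ fun i hi =>
    h i (Finset.mem_sdiff.1 hi).2

theorem exists_tendsto_forall_norm_sub_le [CompleteSpace E] {x : ℕ → E} {δ : ℕ → ℝ}
    (hδ : Antitone δ) (hδ0 : Filter.Tendsto δ Filter.atTop (nhds 0))
    (hx : ∀ n, ‖x (n + 1) - x n‖ ≤ δ n) :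
    ∃ y, Filter.Tendsto x Filter.atTop (nhds y) ∧ ∀ n, ‖y - x n‖ ≤ δ n := by
  have hsub : ∀ n m, n ≤ m → ‖x m - x n‖ ≤ δ n := fun n m hnm => by
    induction m, hnm using Nat.le_induction with
    | base => simpa using (norm_nonneg _).trans (hx n)
    | succ m hnm ih =>
      rw [← sub_add_sub_cancel (x (m + 1)) (x m)]
      exact norm_add_le_of_norm_le ((hx m).trans (hδ hnm)) ih
  obtain ⟨y, hy⟩ := cauchySeq_tendsto_of_complete
    (NonarchimedeanAddGroup.cauchySeq_of_tendsto_sub_nhds_zero (squeeze_zero_norm hx hδ0))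
  refine ⟨y, hy, fun n => le_of_tendsto (hy.sub_const (x n)).norm ?_⟩
  filter_upwards [Filter.eventually_ge_atTop n] with m hnm using hsub n m hnm

end Ultrametric

section Products

variable {F ι : Type*} [NormedField F] [IsUltrametricDist F] {u : ι → F} {δ : ℝ}

theorem norm_prod_one_sub_sub_one_le (T : Finset ι) (h0 : 0 ≤ δ) (h1 : δ ≤ 1)
    (h : ∀ i ∈ T, ‖u i‖ ≤ δ) : ‖∏ i ∈ T, (1 - u i) - 1‖ ≤ δ := by
  classical
  induction T using Finset.induction_on with
  | empty => simpa using h0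
  | insert i T hi ih =>
    have ih := ih fun k hk => h k (Finset.mem_insert_of_mem hk)
    have hui : ‖1 - u i‖ ≤ 1 :=
      norm_sub_le_of_norm_le norm_one.le ((h i (Finset.mem_insert_self i T)).trans h1)
    have hsplit : ∏ k ∈ insert i T, (1 - u k) - 1 =
        (1 - u i) * (∏ k ∈ T, (1 - u k) - 1) - u i := by
      rw [Finset.prod_insert hi]; ring
    rw [hsplit]
    refine norm_sub_le_of_norm_le ?_ (h i (Finset.mem_insert_self i T))
    rw [norm_mul]
    exact (mul_le_of_le_one_left (norm_nonneg _) hui).trans ih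

theorem norm_prod_one_sub_sub_prod_le {S T : Finset ι} (hST : S ⊆ T) (h0 : 0 ≤ δ) (h1 : δ ≤ 1)
    (h : ∀ i ∉ S, ‖u i‖ ≤ δ) :
    ‖∏ i ∈ T, (1 - u i) - ∏ i ∈ S, (1 - u i)‖ ≤ ‖∏ i ∈ S, (1 - u i)‖ * δ := by
  classical
  rw [← Finset.prod_sdiff hST, ← sub_one_mul, norm_mul, mul_comm]
  refine mul_le_mul_of_nonneg_left ?_ (norm_nonneg _)
  exact norm_prod_one_sub_sub_one_le _ h0 h1 fun i hi => h i (Finset.mem_sdiff.1 hi).2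

theorem cauchySeq_prod_one_sub (hu : Filter.Tendsto u Filter.cofinite (nhds 0)) :
    CauchySeq fun S : Finset ι => ∏ i ∈ S, (1 - u i) := by
  classical
  obtain ⟨S₀, hS₀⟩ := exists_forall_notMem_norm_le hu one_pos
  set M := ‖∏ i ∈ S₀, (1 - u i)‖ with hM
  have hbound : ∀ S, S₀ ⊆ S → ‖∏ i ∈ S, (1 - u i)‖ ≤ M := fun S hS => by
    have h := norm_prod_one_sub_sub_prod_le hS zero_le_one le_rfl hS₀
    rw [mul_one] at h
    have h' := norm_add_le_of_norm_le h hM.ge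
    rwa [sub_add_cancel] at h'
  rw [Metric.cauchySeq_iff']
  intro ε hε
  obtain ⟨S₁, hS₁⟩ := exists_forall_notMem_norm_le hu
    (show 0 < min 1 (ε / (2 * (M + 1))) by positivity)
  refine ⟨S₀ ∪ S₁, fun T hT => ?_⟩
  rw [dist_eq_norm]
  calc ‖∏ i ∈ T, (1 - u i) - ∏ i ∈ S₀ ∪ S₁, (1 - u i)‖
      ≤ ‖∏ i ∈ S₀ ∪ S₁, (1 - u i)‖ * min 1 (ε / (2 * (M + 1))) :=
        norm_prod_one_sub_sub_prod_le hT (by positivity) (min_le_left _ _)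
          fun i hi => hS₁ i fun h => hi (Finset.mem_union_right _ h)
    _ ≤ (M + 1) * (ε / (2 * (M + 1))) := by
        gcongr
        · exact (hbound _ Finset.subset_union_left).trans (le_add_of_nonneg_right zero_le_one)
        · exact min_le_right _ _
    _ = ε / 2 := by
        have : M + 1 ≠ 0 := by positivity
        field_simp
    _ < ε := half_lt_self hε

theorem norm_tprod_one_sub_sub_prod_le [CompleteSpace F]
    (hu : Filter.Tendsto u Filter.cofinite (nhds 0)) (S : Finset ι) (h0 : 0 ≤ δ) (h1 : δ ≤ 1)
    (h : ∀ i ∉ S, ‖u i‖ ≤ δ) :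
    ‖∏' i, (1 - u i) - ∏ i ∈ S, (1 - u i)‖ ≤ ‖∏ i ∈ S, (1 - u i)‖ * δ := by
  obtain ⟨a, ha⟩ := cauchySeq_tendsto_of_complete (cauchySeq_prod_one_sub hu)
  have hprod : HasProd (fun i => 1 - u i) a := by simpa [HasProd] using ha
  rw [hprod.tprod_eq]
  refine le_of_tendsto (ha.sub_const _).norm ?_
  filter_upwards [Filter.eventually_ge_atTop S] with T hST
  exact norm_prod_one_sub_sub_prod_le hST h0 h1 h

end Products

section PowerSums

open Polynomial

variable {F : Type*} [Field F] {V : Finset F}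

theorem prod_erase_sub_eq [DecidableEq F] (hV : ∀ x ∈ V, ∀ y ∈ V, x - y ∈ V) {x : F}
    (hx : x ∈ V) : ∏ y ∈ V.erase x, (x - y) = ∏ y ∈ V.erase 0, y := by
  refine Finset.prod_nbij' (x - ·) (x - ·) (fun y hy => ?_) (fun y hy => ?_) (by simp) (by simp)
    (by simp)
  · rw [Finset.mem_erase] at hy ⊢
    exact ⟨sub_ne_zero.2 hy.1.symm, hV x hx y hy.2⟩
  · rw [Finset.mem_erase] at hy ⊢
    exact ⟨fun h => hy.1 (by simpa using h), hV x hx y hy.2⟩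

-- The sum is, up to a nonzero factor, the top coefficient of the polynomial interpolating `G` on
-- `V`: the Lagrange weights are all equal because `V` is a group.
theorem sum_eval_eq_zero_of_natDegree_lt (hV : ∀ x ∈ V, ∀ y ∈ V, x - y ∈ V) {G : F[X]}
    (hG : G.natDegree + 1 < V.card) : ∑ x ∈ V, G.eval x = 0 := by
  classical
  have hdeg : G.degree < (V.card : WithBot ℕ) :=
    degree_le_natDegree.trans_lt (by exact_mod_cast (by omega))
  have htop := Lagrange.coeff_eq_sum (s := V) (v := id) (Set.injOn_id _) hdeg
  simp only [id] at htop
  rw [coeff_eq_zero_of_natDegree_lt (by omega),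
    Finset.sum_congr rfl fun x hx => by rw [prod_erase_sub_eq hV hx], ← Finset.sum_div, eq_comm,
    div_eq_zero_iff] at htop
  exact htop.resolve_right (Finset.prod_ne_zero_iff.2 fun y hy => (Finset.mem_erase.1 hy).1)

-- The term at `x = 0` is zero, because `0⁻¹ = 0`.
theorem sum_eval_mul_inv_eq_neg_coeff_one (hV : ∀ x ∈ V, ∀ y ∈ V, x - y ∈ V) {G : F[X]}
    (hG0 : G.coeff 0 = 0) (hG : G.natDegree < V.card) :
    ∑ x ∈ V, G.eval x * x⁻¹ = -G.coeff 1 := by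
  classical
  obtain ⟨y, hy⟩ : V.Nonempty := Finset.card_pos.1 (by omega)
  have h0 : (0 : F) ∈ V := by simpa using hV y hy y hy
  have hGX : G.divX * X = G := by simpa [hG0] using G.divX_mul_X_add
  have heval : ∀ x ∈ V.erase 0, G.eval x * x⁻¹ = G.divX.eval x := fun x hx => by
    conv_lhs => rw [← hGX, eval_mul_X, mul_inv_cancel_right₀ (Finset.mem_erase.1 hx).1]
  have hzero : ∑ x ∈ V, G.divX.eval x = 0 := by
    rcases Nat.eq_zero_or_pos G.natDegree with hd | hd
    · have : G = 0 := by rw [eq_C_of_natDegree_eq_zero hd, hG0, C_0]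
      simp [this]
    · exact sum_eval_eq_zero_of_natDegree_lt hV
        (by rw [natDegree_divX_eq_natDegree_tsub_one]; omega)
  rw [← Finset.sum_erase_add _ _ h0, inv_zero, mul_zero, add_zero, Finset.sum_congr rfl heval,
    Finset.sum_erase_eq_sub h0, hzero, zero_sub, ← coeff_zero_eq_eval_zero, coeff_divX]

end PowerSums

section CompletedTensor

variable {Fq C M : Type*} [Field Fq] [NormedField C] [Algebra Fq C] [AddCommGroup M] [Module Fq M]

theorem ofTensor_tmul_apply (c : C) (m : M) (χ : Module.Dual Fq M) :
    (ofTensor Fq C M (c ⊗ₜ m)).1 χ = χ m • c :=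
  rfl

theorem exists_finset_forall_ofTensor_apply_eq_zero (x : C ⊗[Fq] M) :
    ∃ S : Finset M, ∀ χ : Module.Dual Fq M, (∀ m ∈ S, χ m = 0) → (ofTensor Fq C M x).1 χ = 0 := by
  classical
  induction x with
  | zero => exact ⟨∅, fun χ _ => by simp⟩
  | tmul c m => exact ⟨{m}, fun χ hχ => by simp [ofTensor_tmul_apply, hχ m (by simp)]⟩
  | add x y hx hy =>
    obtain ⟨S, hS⟩ := hx
    obtain ⟨T, hT⟩ := hy
    refine ⟨S ∪ T, fun χ hχ => ?_⟩
    rw [map_add, Submodule.coe_add, LinearMap.add_apply,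
      hS χ fun m hm => hχ m (Finset.mem_union_left _ hm),
      hT χ fun m hm => hχ m (Finset.mem_union_right _ hm), add_zero]

theorem comp_subtype_comp_eq_sum {W : Submodule Fq M} {ι : Type*} [Fintype ι]
    (b : Module.Basis ι Fq W) (p : M →ₗ[Fq] W) (χ : Module.Dual Fq M) :
    χ ∘ₗ W.subtype ∘ₗ p = ∑ i, χ (b i) • (b.coord i ∘ₗ p) := by
  ext m
  conv_lhs => rw [LinearMap.comp_apply, LinearMap.comp_apply, ← b.sum_repr (p m), map_sum, map_sum]
  simp only [map_smul, Submodule.subtype_apply, smul_eq_mul, LinearMap.sum_apply,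
    LinearMap.smul_apply, LinearMap.comp_apply, Module.Basis.coord_apply, mul_comm]

theorem mem_range_ofTensor_iff (f : CTensor Fq C M) :
    f ∈ LinearMap.range (ofTensor Fq C M) ↔
      ∃ S : Finset M, ∀ χ : Module.Dual Fq M, (∀ m ∈ S, χ m = 0) → f.1 χ = 0 := by
  constructor
  · rintro ⟨x, rfl⟩
    exact exists_finset_forall_ofTensor_apply_eq_zero x
  · rintro ⟨S, hS⟩
    let W := Submodule.span Fq (S : Set M)
    have : FiniteDimensional Fq W := FiniteDimensional.span_finset Fq S
    obtain ⟨p, hp⟩ := LinearMap.exists_leftInverse_of_injective W.subtype W.ker_subtype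
    let b := Module.finBasis Fq W
    refine ⟨∑ i, f.1 (b.coord i ∘ₗ p) ⊗ₜ (b i : M), Subtype.ext (LinearMap.ext fun χ => ?_)⟩
    have hχ : f.1 χ = f.1 (χ ∘ₗ W.subtype ∘ₗ p) := by
      rw [← sub_eq_zero, ← map_sub]
      refine hS _ fun m hm => ?_
      have hpm : p m = ⟨m, Submodule.subset_span hm⟩ :=
        LinearMap.congr_fun hp ⟨m, Submodule.subset_span hm⟩
      simp [hpm]
    rw [hχ, comp_subtype_comp_eq_sum b]
    simp only [map_sum, map_smul, Submodule.coe_sum, LinearMap.sum_apply, ofTensor_tmul_apply]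

variable {A : Type*} [CommRing A] [Algebra Fq A] [Module A M] [IsScalarTower Fq A M]

theorem tensorAction_add (g h : C ⊗[Fq] A) (f : CTensor Fq C M) :
    tensorAction Fq C M A (g + h) f = tensorAction Fq C M A g f + tensorAction Fq C M A h f :=
  map_add (tensorSMulHom f) g h

theorem tensorAction_sub (g h : C ⊗[Fq] A) (f : CTensor Fq C M) :
    tensorAction Fq C M A (g - h) f = tensorAction Fq C M A g f - tensorAction Fq C M A h f :=
  map_sub (tensorSMulHom f) g h

theorem tensorAction_diagonal_apply [Algebra A C] (f : CTensor Fq C M) (a : A)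
    (χ : Module.Dual Fq M) :
    (tensorAction Fq C M A (algebraMap A C a ⊗ₜ[Fq] (1 : A) - (1 : C) ⊗ₜ[Fq] a) f).1 χ =
      algebraMap A C a * f.1 χ - f.1 (χ ∘ₗ Algebra.lsmul Fq Fq M a) := by
  have hone : χ ∘ₗ Algebra.lsmul Fq Fq M (1 : A) = χ :=
    LinearMap.ext fun m => congrArg χ (one_smul A m)
  rw [tensorAction_sub, Submodule.coe_sub, LinearMap.sub_apply, tensorAction_tmul,
    tensorAction_tmul, hone, one_mul]

theorem zero_tensorAction (f : CTensor Fq C M) : tensorAction Fq C M A 0 f = 0 :=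
  map_zero (tensorSMulHom f)

theorem tensorAction_zero (h : C ⊗[Fq] A) : tensorAction Fq C M A h 0 = 0 := by
  induction h with
  | zero => exact zero_tensorAction 0
  | add g h hg hh => rw [tensorAction_add, hg, hh, add_zero]
  | tmul c a => exact Subtype.ext (LinearMap.ext fun χ => by simp [tensorAction_tmul])

theorem tensorAction_mul (g h : C ⊗[Fq] A) (f : CTensor Fq C M) :
    tensorAction Fq C M A (g * h) f = tensorAction Fq C M A g (tensorAction Fq C M A h f) := by
  induction g with
  | zero => rw [zero_mul, zero_tensorAction, zero_tensorAction]
  | add g₁ g₂ h₁ h₂ => rw [add_mul, tensorAction_add, tensorAction_add, h₁, h₂]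
  | tmul c a =>
    induction h with
    | zero => rw [mul_zero, zero_tensorAction, tensorAction_zero]
    | add h₁ h₂ e₁ e₂ =>
      rw [mul_add, tensorAction_add, tensorAction_add, e₁, e₂]
      refine Subtype.ext (LinearMap.ext fun χ => ?_)
      simp only [tensorAction_tmul, Submodule.coe_add, LinearMap.add_apply, mul_add]
    | tmul d b =>
      refine Subtype.ext (LinearMap.ext fun χ => ?_)
      rw [Algebra.TensorProduct.tmul_mul_tmul, tensorAction_tmul, tensorAction_tmul,
        tensorAction_tmul, mul_assoc]
      congr 3
      ext m
      simp

theorem tensorAction_mem_range_ofTensor (h : C ⊗[Fq] A) {f : CTensor Fq C M}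
    (hf : f ∈ LinearMap.range (ofTensor Fq C M)) :
    tensorAction Fq C M A h f ∈ LinearMap.range (ofTensor Fq C M) := by
  classical
  induction h with
  | zero => rw [zero_tensorAction]; exact zero_mem _
  | add g h hg hh => rw [tensorAction_add]; exact add_mem hg hh
  | tmul c a =>
    obtain ⟨S, hS⟩ := (mem_range_ofTensor_iff f).1 hf
    refine (mem_range_ofTensor_iff _).2 ⟨S.image (a • ·), fun χ hχ => ?_⟩
    have h : f.1 (χ ∘ₗ Algebra.lsmul Fq Fq M a) = 0 :=
      hS _ fun m hm => hχ (a • m) (Finset.mem_image_of_mem _ hm)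
    rw [tensorAction_tmul, h, mul_zero]

theorem tensorAction_mem_range_of_mem_diagonalIdeal [Algebra A C] {f : CTensor Fq C M}
    (hf : ∀ a : A, tensorAction Fq C M A (algebraMap A C a ⊗ₜ[Fq] (1 : A) - (1 : C) ⊗ₜ[Fq] a) f ∈
      LinearMap.range (ofTensor Fq C M)) {h : C ⊗[Fq] A} (hh : h ∈ diagonalIdeal Fq C A) :
    tensorAction Fq C M A h f ∈ LinearMap.range (ofTensor Fq C M) := by
  refine Submodule.span_induction ?_ ?_ ?_ ?_ hh
  · rintro _ ⟨a, rfl⟩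
    exact hf a
  · rw [zero_tensorAction]
    exact zero_mem _
  · intro x y _ _ hx hy
    rw [tensorAction_add]
    exact add_mem hx hy
  · intro g x _ hx
    rw [smul_eq_mul, tensorAction_mul]
    exact tensorAction_mem_range_ofTensor g hx

end CompletedTensor

section Twist

variable {Fq C M : Type*} [Field Fq] [Fintype Fq] [NormedField C] [Algebra Fq C] [AddCommGroup M]
  [Module Fq M]

theorem twist_apply (j : ℕ) (f : CTensor Fq C M) (χ : Module.Dual Fq M) :
    (twist j f).1 χ = f.1 χ ^ Fintype.card Fq ^ j := by
  simp [twist, AlgHom.coe_pow, FiniteField.coe_frobeniusAlgHom, pow_iterate]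

theorem twist_zero_left (f : CTensor Fq C M) : twist 0 f = f :=
  Subtype.ext (LinearMap.ext fun χ => by rw [twist_apply, pow_zero, pow_one])

theorem twist_zero_right (j : ℕ) : twist j (0 : CTensor Fq C M) = 0 :=
  Subtype.ext (LinearMap.ext fun χ => by simp [twist])

end Twist

section NonZeroDivisors

variable {k R A : Type*} [CommRing k] [CommRing R] [Algebra k R] [Module.Flat k R] [CommRing A]
  [Algebra k A]

theorem lTensor_eq_zero_of_ker_le_ker {M N P : Type*} [AddCommGroup M] [Module k M]
    [AddCommGroup N] [Module k N] [AddCommGroup P] [Module k P] {f : M →ₗ[k] N} {g : M →ₗ[k] P}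
    (hfg : LinearMap.ker f ≤ LinearMap.ker g) {x : R ⊗[k] M} (hx : f.lTensor R x = 0) :
    g.lTensor R x = 0 := by
  obtain ⟨y, rfl⟩ := (Module.Flat.lTensor_exact R (LinearMap.exact_subtype_ker_map f) x).1 hx
  have hzero : g ∘ₗ (LinearMap.ker f).subtype = 0 := LinearMap.ext fun m => hfg m.2
  rw [← LinearMap.lTensor_comp_apply, hzero, LinearMap.lTensor_zero, LinearMap.zero_apply]

theorem exists_lTensor_mkQ_eq_zero {V : ℕ → Submodule k A} (hmono : Monotone V)
    (hexh : ∀ a, ∃ n, a ∈ V n) (x : R ⊗[k] A) : ∃ n, (V n).mkQ.lTensor R x = 0 := by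
  induction x with
  | zero => exact ⟨0, map_zero _⟩
  | tmul c a =>
    obtain ⟨n, hn⟩ := hexh a
    exact ⟨n, by rw [LinearMap.lTensor_tmul, Submodule.mkQ_apply,
      (Submodule.Quotient.mk_eq_zero _).2 hn, TensorProduct.tmul_zero]⟩
  | add x y hx hy =>
    obtain ⟨n, hn⟩ := hx
    obtain ⟨m, hm⟩ := hy
    have hle : ∀ {i j}, i ≤ j → LinearMap.ker (V i).mkQ ≤ LinearMap.ker (V j).mkQ := fun hij => by
      simpa only [Submodule.ker_mkQ] using hmono hij
    refine ⟨max n m, ?_⟩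
    rw [map_add, lTensor_eq_zero_of_ker_le_ker (hle (le_max_left n m)) hn,
      lTensor_eq_zero_of_ker_le_ker (hle (le_max_right n m)) hm, add_zero]

-- If `x` is killed by `c ⊗ 1 - 1 ⊗ t`, then `(1 ⊗ t) x = (c ⊗ 1) x` lies in every step of the
-- filtration that contains `x`; as `t` shifts the filtration, `x` then lies one step lower.
theorem tmul_one_sub_one_tmul_mem_nonZeroDivisors (c : R) {t : A} {V : ℕ → Submodule k A}
    (h0 : V 0 = ⊥) (hmono : Monotone V) (hexh : ∀ a, ∃ n, a ∈ V n)
    (ht : ∀ n a, t * a ∈ V (n + 1) → a ∈ V n) :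
    c ⊗ₜ[k] (1 : A) - (1 : R) ⊗ₜ[k] t ∈ nonZeroDivisors (R ⊗[k] A) := by
  rw [mem_nonZeroDivisors_iff_left]
  intro x hx
  have hmulLeft : ∀ y : R ⊗[k] A, (LinearMap.mulLeft k t).lTensor R y = (1 : R) ⊗ₜ[k] t * y :=
    fun y => by
      induction y with
      | zero => simp
      | tmul d a => simp
      | add y z hy hz => rw [map_add, hy, hz, mul_add]
  have hsmul : (LinearMap.mulLeft k t).lTensor R x = c • x := by
    rw [hmulLeft, ← sub_eq_zero.1 ((sub_mul _ _ x).symm.trans hx), Algebra.smul_def,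
      Algebra.TensorProduct.algebraMap_apply, Algebra.algebraMap_self_apply]
  have hdescend : ∀ n, (V (n + 1)).mkQ.lTensor R x = 0 → (V n).mkQ.lTensor R x = 0 := by
    intro n hn
    refine lTensor_eq_zero_of_ker_le_ker (f := (V (n + 1)).mkQ ∘ₗ LinearMap.mulLeft k t) ?_ ?_
    · intro a ha
      rw [LinearMap.mem_ker, LinearMap.comp_apply, Submodule.mkQ_apply,
        Submodule.Quotient.mk_eq_zero] at ha
      simpa using ht n a ha
    · have hbase : ∀ y : R ⊗[k] A, (V (n + 1)).mkQ.lTensor R (c • y) =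
          c • (V (n + 1)).mkQ.lTensor R y := (TensorProduct.AlgebraTensorModule.lTensor R R
            (V (n + 1)).mkQ).map_smul c
      rw [LinearMap.lTensor_comp_apply, hsmul, hbase, hn, smul_zero]
  obtain ⟨n, hn⟩ := exists_lTensor_mkQ_eq_zero hmono hexh x
  have hbot : (V 0).mkQ.lTensor R x = 0 := by
    induction n with
    | zero => exact hn
    | succ n ih => exact ih (hdescend n hn)
  have hid := lTensor_eq_zero_of_ker_le_ker (g := LinearMap.id) (by simp [h0]) hbot
  rwa [LinearMap.lTensor_id, LinearMap.id_apply] at hid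

end NonZeroDivisors

section Constants

variable {F E : Type*} [Field F] [Field E] [Algebra F E]

theorem isIntegral_of_forall_mem_valuationSubring {x : E}
    (hx : ∀ V : ValuationSubring E, (∀ c, algebraMap F E c ∈ V) → x ∈ V) : IsIntegral F x := by
  let F' : Subring E := (⊥ : Subalgebra F E).toSubring
  have hmem : x ∈ (integralClosure (Subring.closure (F' : Set E)) E).toSubring := by
    rw [← iInf_valuationSubring_superset, Subring.mem_iInf]
    rintro ⟨V, hV⟩
    exact hx V fun c => hV (algebraMap_mem (⊥ : Subalgebra F E) c)
  rw [Subring.closure_eq] at hmem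
  have hint : IsIntegral (⊥ : Subalgebra F E) x := hmem
  exact isIntegral_trans (R := F) x hint

theorem exists_pow_eq_pow_of_isIntegral [Finite F] {x : E} (hx : IsIntegral F x) :
    ∃ m n, m < n ∧ x ^ m = x ^ n := by
  have hfinite : Module.Finite F (Algebra.adjoin F {x}) :=
    ⟨(Submodule.fg_top _).2 hx.fg_adjoin_singleton⟩
  have : Finite (Algebra.adjoin F {x}) := Module.finite_of_finite F
  exact (Set.toFinite (Algebra.adjoin F {x} : Set E)).exists_lt_map_eq_of_forall_mem
    fun n : ℕ => pow_mem (Algebra.self_mem_adjoin_singleton F x) n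

end Constants

section NormSMul

variable {Fq C : Type*} [Field Fq]

variable (Fq) in
theorem one_lt_card [Fintype Fq] : (1 : ℝ) < Fintype.card Fq := by
  exact_mod_cast Fintype.one_lt_card

theorem norm_smul_eq [Finite Fq] [NormedField C] [Algebra Fq C] {k : Fq} (hk : k ≠ 0) (c : C) :
    ‖k • c‖ = ‖c‖ := by
  have := Fintype.ofFinite Fq
  refine le_antisymm (norm_smul_le' k c) ?_
  simpa only [smul_smul, inv_mul_cancel₀ hk, one_smul] using norm_smul_le' k⁻¹ (k • c)

end NormSMul

section KInfty

variable {Fq A K C : Type*} [Field Fq] [Field K] [NormedField C] [Algebra K C]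

theorem algebraMap_mem_kInfty (x : K) : algebraMap K C x ∈ kInfty K C :=
  Subfield.le_topologicalClosure _ ⟨x, rfl⟩

theorem isClosed_kInfty : IsClosed (kInfty K C : Set C) :=
  Subfield.isClosed_topologicalClosure _

theorem exists_norm_sub_lt_of_mem_kInfty {x : C} (hx : x ∈ kInfty K C) {ε : ℝ} (hε : 0 < ε) :
    ∃ y : K, ‖algebraMap K C y - x‖ < ε := by
  have hclosure : x ∈ closure (Set.range (algebraMap K C)) := hx
  obtain ⟨_, ⟨y, rfl⟩, hy⟩ := Metric.mem_closure_iff.1 hclosure ε hε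
  exact ⟨y, by rwa [dist_comm, dist_eq_norm] at hy⟩

theorem smul_mem_kInfty [Algebra Fq K] [Algebra Fq C] [IsScalarTower Fq K C] (c : Fq) {x : C}
    (hx : x ∈ kInfty K C) : c • x ∈ kInfty K C := by
  rw [Algebra.smul_def, IsScalarTower.algebraMap_apply Fq K C]
  exact mul_mem (algebraMap_mem_kInfty _) hx

theorem algebraMap_mem_kInfty_of_isScalarTower [CommRing A] [Algebra A K] [Algebra A C]
    [IsScalarTower A K C] (a : A) : algebraMap A C a ∈ kInfty K C := by
  rw [IsScalarTower.algebraMap_apply A K C]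
  exact algebraMap_mem_kInfty _

variable [Fintype Fq] [CompleteSpace C] {O : ValuationSubring K}

theorem norm_lt_one_of_mem_nonunits (hC : IsCInfty Fq C O) {x : K} (hx : x ∈ O.nonunits) :
    ‖algebraMap K C x‖ < 1 := by
  rcases eq_or_ne x 0 with rfl | hx0
  · simp
  have hinv : ¬ ‖algebraMap K C x⁻¹‖ ≤ 1 := by
    rw [hC.norm_le_one_iff, ← ValuationSubring.valuation_le_one_iff, map_inv₀, not_le]
    exact (one_lt_inv₀ (zero_lt_iff.2 (by simpa using hx0))).2
      ((ValuationSubring.mem_nonunits_iff O).1 hx)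
  rw [map_inv₀, norm_inv, not_le] at hinv
  exact (one_lt_inv₀ (norm_pos_iff.2 (by simpa using hx0))).1 hinv

section ResidueField

variable [Algebra Fq K] [Algebra Fq C] [IsScalarTower Fq K C] [CommRing A] [Algebra A K]

theorem exists_norm_algebraMap_sub_lt_one (hA : IsRingOfFunctionsAwayFrom Fq A O)
    (hC : IsCInfty Fq C O) {x : K} (hx : ‖algebraMap K C x‖ ≤ 1) :
    ∃ c : Fq, ‖algebraMap K C x - algebraMap Fq C c‖ < 1 := by
  obtain ⟨c, hc⟩ := hA.degree_one x ((hC.norm_le_one_iff x).1 hx)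
  refine ⟨c, ?_⟩
  rw [IsScalarTower.algebraMap_apply Fq K C, ← map_sub]
  exact norm_lt_one_of_mem_nonunits hC hc

theorem exists_norm_sub_smul_lt [IsUltrametricDist C] (hA : IsRingOfFunctionsAwayFrom Fq A O)
    (hC : IsCInfty Fq C O) {x y : C} (hx : x ∈ kInfty K C) (hy : y ∈ kInfty K C) (hy0 : y ≠ 0)
    (h : ‖x‖ ≤ ‖y‖) : ∃ c : Fq, ‖x - c • y‖ < ‖y‖ := by
  have hypos : 0 < ‖y‖ := norm_pos_iff.2 hy0
  obtain ⟨z, hz⟩ := exists_norm_sub_lt_of_mem_kInfty (div_mem hx hy) one_pos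
  have hxy : ‖x / y‖ ≤ 1 := by rw [norm_div]; exact (div_le_one hypos).2 h
  obtain ⟨c, hc⟩ := exists_norm_algebraMap_sub_lt_one hA hC (x := z) (by
    simpa only [sub_add_cancel] using norm_add_le_of_norm_le hz.le hxy)
  have hquot : ‖x / y - algebraMap Fq C c‖ < 1 := by
    rw [← sub_add_sub_cancel _ (algebraMap K C z), ← neg_sub (algebraMap K C z)]
    exact (IsUltrametricDist.norm_add_le_max _ _).trans_lt (max_lt (by rwa [norm_neg]) hc)
  refine ⟨c, ?_⟩
  have hfactor : x - c • y = (x / y - algebraMap Fq C c) * y := by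
    rw [sub_mul, div_mul_cancel₀ x hy0, Algebra.smul_def]
  rw [hfactor, norm_mul]
  exact mul_lt_of_lt_one_left hypos hquot

end ResidueField

theorem exists_norm_eq_zpow_of_mem_kInfty [IsUltrametricDist C] (hC : IsCInfty Fq C O) {x : C}
    (hx : x ∈ kInfty K C) (hx0 : x ≠ 0) : ∃ n : ℤ, ‖x‖ = (Fintype.card Fq : ℝ) ^ n := by
  obtain ⟨y, hy⟩ := exists_norm_sub_lt_of_mem_kInfty hx (norm_pos_iff.2 hx0)
  have hnorm := norm_eq_of_norm_sub_lt hy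
  rw [← hnorm]
  refine hC.norm_eq_zpow y ?_
  rintro rfl
  rw [map_zero, norm_zero] at hnorm
  exact hx0 (norm_eq_zero.1 hnorm.symm)

theorem norm_le_zpow_of_norm_lt_zpow [IsUltrametricDist C] (hC : IsCInfty Fq C O) {x : C}
    (hx : x ∈ kInfty K C) {n : ℤ} (h : ‖x‖ < (Fintype.card Fq : ℝ) ^ (n + 1)) :
    ‖x‖ ≤ (Fintype.card Fq : ℝ) ^ n := by
  have hq := one_lt_card Fq
  rcases eq_or_ne x 0 with rfl | hx0
  · rw [norm_zero]; positivity
  obtain ⟨m, hm⟩ := exists_norm_eq_zpow_of_mem_kInfty hC hx hx0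
  rw [hm, zpow_lt_zpow_iff_right₀ hq] at h
  rw [hm, zpow_le_zpow_iff_right₀ hq]
  omega

end KInfty

theorem exists_forall_exists_add_eq {S : Set ℕ} {D : ℕ} (hD : 0 < D) (hS : ∀ n ∈ S, n + D ∈ S) :
    ∃ M, ∀ n ∈ S, M < n → ∃ k ∈ S, k + D = n := by
  have hadd : ∀ n ∈ S, ∀ i, n + D * i ∈ S := fun n hn i => by
    induction i with
    | zero => simpa using hn
    | succ i ih => rw [Nat.mul_succ, ← add_assoc]; exact hS _ ih
  have hinj : Set.InjOn (· % D) {n ∈ S | ∀ k ∈ S, k + D ≠ n} := by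
    have hle : ∀ n ∈ S, ∀ m, (∀ k ∈ S, k + D ≠ m) → n % D = m % D → m ≤ n := by
      intro n hn m hm hmod
      by_contra! hlt
      obtain ⟨i, hi⟩ : D ∣ m - n := (Nat.modEq_iff_dvd' hlt.le).1 hmod
      obtain _ | i := i
      · omega
      · exact hm _ (hadd n hn i) (by rw [Nat.mul_succ] at hi; omega)
    exact fun n hn m hm hmod => (hle m hm.1 n hn.2 hmod.symm).antisymm (hle n hn.1 m hm.2 hmod)
  have hfin : {n ∈ S | ∀ k ∈ S, k + D ≠ n}.Finite :=
    Set.Finite.of_injOn (fun n _ => Nat.mod_lt n hD) hinj (Set.finite_Iio D)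
  obtain ⟨M, hM⟩ := hfin.bddAbove
  refine ⟨M, fun n hn hlt => ?_⟩
  by_contra! hne
  exact hlt.not_ge (hM ⟨hn, hne⟩)

theorem wellFounded_lt_of_finite {α β : Type*} [LinearOrder β] {f : α → β}
    (hf : ∀ b, {a | f a ≤ b}.Finite) : WellFounded fun a a' => f a < f a' := by
  refine Subrelation.wf (fun {a a'} h => ?_) (measure fun a => {b | f b < f a}.ncard).wf
  refine Set.ncard_lt_ncard ((Set.ssubset_iff_of_subset fun b hb => lt_trans hb h).2 ?_)
    ((hf (f a')).subset fun b hb => le_of_lt hb)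
  exact ⟨a, h, lt_irrefl (f a)⟩

section Curve

variable {Fq A K C : Type*} [Field Fq] [Fintype Fq] [CommRing A] [Field K] [NormedField C]
  [CompleteSpace C] [Algebra Fq A] [Algebra Fq K] [Algebra Fq C] [Algebra A K] [Algebra A C]
  [Algebra K C] [IsScalarTower Fq A K] [IsScalarTower Fq A C] [IsScalarTower A K C]
  {O : ValuationSubring K}

-- A function regular everywhere is integral over `Fq`; if it also vanishes at `∞`, then it is
-- zero, since two of its powers coincide.
theorem exists_algebraMap_eq_of_norm_le_one [FaithfulSMul A K]
    (hA : IsRingOfFunctionsAwayFrom Fq A O) (hC : IsCInfty Fq C O) {a : A}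
    (ha : ‖algebraMap A C a‖ ≤ 1) : ∃ c : Fq, algebraMap Fq A c = a := by
  have htower : IsScalarTower Fq K C := IsScalarTower.to₁₃₄ Fq A K C
  rw [IsScalarTower.algebraMap_apply A K C] at ha
  obtain ⟨c, hc⟩ := exists_norm_algebraMap_sub_lt_one hA hC ha
  rw [IsScalarTower.algebraMap_apply Fq K C, ← map_sub] at hc
  refine ⟨c, FaithfulSMul.algebraMap_injective A K ?_⟩
  rw [← IsScalarTower.algebraMap_apply]
  by_contra! hne
  have hint : IsIntegral Fq (algebraMap A K a - algebraMap Fq K c) := by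
    refine isIntegral_of_forall_mem_valuationSubring fun V hV => sub_mem ?_ (hV c)
    rcases eq_or_ne V O with rfl | hVO
    · exact (hC.norm_le_one_iff _).1 ha
    · exact (hA.mem_range_iff _).1 ⟨a, rfl⟩ V hV hVO
  obtain ⟨m, n, hmn, hpow⟩ := exists_pow_eq_pow_of_isIntegral hint
  have hnorm := congrArg (fun z => ‖algebraMap K C z‖) hpow
  simp only [map_pow, norm_pow] at hnorm
  refine (pow_lt_pow_right_of_lt_one₀ (norm_pos_iff.2 ?_) hc hmn).ne' hnorm
  rw [ne_eq, map_eq_zero_iff _ (algebraMap K C).injective, sub_eq_zero]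
  exact hne.symm

theorem one_le_norm_of_ne_zero [FaithfulSMul A K] (hA : IsRingOfFunctionsAwayFrom Fq A O)
    (hC : IsCInfty Fq C O) {a : A} (ha : a ≠ 0) : 1 ≤ ‖algebraMap A C a‖ := by
  by_contra! hlt
  obtain ⟨c, rfl⟩ := exists_algebraMap_eq_of_norm_le_one hA hC hlt.le
  have hc : c ≠ 0 := by rintro rfl; exact ha (map_zero _)
  rw [← IsScalarTower.algebraMap_apply Fq A C, Algebra.algebraMap_eq_smul_one, norm_smul_eq hc,
    norm_one] at hlt
  exact hlt.false

theorem exists_norm_eq_pow [FaithfulSMul A K] (hA : IsRingOfFunctionsAwayFrom Fq A O)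
    (hC : IsCInfty Fq C O) {a : A} (ha : a ≠ 0) :
    ∃ n : ℕ, ‖algebraMap A C a‖ = (Fintype.card Fq : ℝ) ^ n := by
  have hone := one_le_norm_of_ne_zero hA hC ha
  obtain ⟨n, hn⟩ := hC.norm_eq_zpow (algebraMap A K a)
    (by simpa using (FaithfulSMul.algebraMap_injective A K).ne ha)
  rw [← IsScalarTower.algebraMap_apply A K C] at hn
  rw [hn, one_le_zpow_iff_right₀ (one_lt_card Fq)] at hone
  lift n to ℕ using hone
  exact ⟨n, by rw [hn, zpow_natCast]⟩

theorem exists_forall_exists_norm_mul_eq [FaithfulSMul A K]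
    (hA : IsRingOfFunctionsAwayFrom Fq A O) (hC : IsCInfty Fq C O)
    {t : A} (ht : 1 < ‖algebraMap A C t‖) :
    ∃ R, 0 ≤ R ∧ ∀ a : A, R < ‖algebraMap A C a‖ →
      ∃ b, ‖algebraMap A C (t * b)‖ = ‖algebraMap A C a‖ := by
  have hq := one_lt_card Fq
  obtain ⟨D, hD⟩ := exists_norm_eq_pow hA hC (a := t) (by rintro rfl; simp at ht; linarith)
  have hD0 : 0 < D := Nat.pos_of_ne_zero (by rintro rfl; simp [hD] at ht)
  obtain ⟨M, hM⟩ := exists_forall_exists_add_eq hD0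
    (S := {n | ∃ a : A, ‖algebraMap A C a‖ = (Fintype.card Fq : ℝ) ^ n}) (by
      rintro n ⟨a, ha⟩
      exact ⟨a * t, by rw [map_mul, norm_mul, ha, hD, pow_add]⟩)
  refine ⟨(Fintype.card Fq : ℝ) ^ M, by positivity, fun a ha => ?_⟩
  obtain ⟨n, hn⟩ := exists_norm_eq_pow hA hC (a := a) (by
    rintro rfl
    rw [map_zero, norm_zero] at ha
    exact ha.not_ge (by positivity))
  rw [hn] at ha
  obtain ⟨k, ⟨b, hb⟩, rfl⟩ := hM n ⟨a, hn⟩ ((pow_lt_pow_iff_right₀ hq).1 ha)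
  exact ⟨b, by rw [map_mul, norm_mul, hb, hD, hn, pow_add, mul_comm]⟩

theorem exists_one_lt_norm [IsFractionRing A K] (hA : IsRingOfFunctionsAwayFrom Fq A O)
    (hC : IsCInfty Fq C O) : ∃ t : A, 1 < ‖algebraMap A C t‖ := by
  by_contra! h
  refine hA.ne_top (eq_top_iff.2 fun x _ => ?_)
  obtain ⟨a, b, _, rfl⟩ := IsFractionRing.div_surjective (A := A) x
  obtain ⟨c, rfl⟩ := exists_algebraMap_eq_of_norm_le_one hA hC (h a)
  obtain ⟨d, rfl⟩ := exists_algebraMap_eq_of_norm_le_one hA hC (h b)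
  rw [← IsScalarTower.algebraMap_apply, ← IsScalarTower.algebraMap_apply, ← map_div₀]
  exact hA.algebraMap_mem _

section Ultrametric

variable [IsUltrametricDist C]

theorem exists_norm_sub_smul_lt_algebraMap [FaithfulSMul A C]
    (hA : IsRingOfFunctionsAwayFrom Fq A O) (hC : IsCInfty Fq C O) {a b : A} (hb : b ≠ 0)
    (h : ‖algebraMap A C a‖ ≤ ‖algebraMap A C b‖) :
    ∃ c : Fq, ‖algebraMap A C (a - c • b)‖ < ‖algebraMap A C b‖ := by
  have htower : IsScalarTower Fq K C := IsScalarTower.to₁₃₄ Fq A K C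
  obtain ⟨c, hc⟩ := exists_norm_sub_smul_lt hA hC (algebraMap_mem_kInfty_of_isScalarTower a)
    (algebraMap_mem_kInfty_of_isScalarTower b)
    ((map_ne_zero_iff _ (FaithfulSMul.algebraMap_injective A C)).2 hb) h
  exact ⟨c, by rwa [map_sub, algebraMap.smul]⟩

variable [FaithfulSMul A K]

theorem finite_norm_lt_pow (hA : IsRingOfFunctionsAwayFrom Fq A O) (hC : IsCInfty Fq C O)
    (n : ℕ) : {a : A | ‖algebraMap A C a‖ < (Fintype.card Fq : ℝ) ^ n}.Finite := by
  have : FaithfulSMul A C := FaithfulSMul.trans A K C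
  induction n with
  | zero =>
    refine (Set.finite_singleton 0).subset fun a ha => ?_
    by_contra! hne
    exact (one_le_norm_of_ne_zero hA hC hne).not_gt (by simpa using ha)
  | succ n ih =>
    have hle : ∀ a : A, ‖algebraMap A C a‖ < (Fintype.card Fq : ℝ) ^ (n + 1) →
        ‖algebraMap A C a‖ ≤ (Fintype.card Fq : ℝ) ^ n := fun a ha => by
      exact_mod_cast norm_le_zpow_of_norm_lt_zpow hC (n := n)
        (algebraMap_mem_kInfty_of_isScalarTower a) (by exact_mod_cast ha)
    by_cases hex : ∃ b : A, ‖algebraMap A C b‖ = (Fintype.card Fq : ℝ) ^ n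
    · obtain ⟨b, hb⟩ := hex
      have hb0 : b ≠ 0 := by
        rintro rfl
        rw [map_zero, norm_zero] at hb
        exact absurd hb.symm (by positivity)
      refine ((Set.finite_univ (α := Fq)).image2 (fun c a => c • b + a) ih).subset fun a ha => ?_
      obtain ⟨c, hc⟩ := exists_norm_sub_smul_lt_algebraMap hA hC hb0 ((hle a ha).trans_eq hb.symm)
      exact ⟨c, trivial, a - c • b, hb ▸ hc, add_sub_cancel _ _⟩
    · exact ih.subset fun a ha => (hle a ha).lt_of_ne fun h => hex ⟨a, h⟩

theorem finite_norm_le (hA : IsRingOfFunctionsAwayFrom Fq A O) (hC : IsCInfty Fq C O)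
    (R : ℝ) : {a : A | ‖algebraMap A C a‖ ≤ R}.Finite := by
  obtain ⟨n, hn⟩ := pow_unbounded_of_one_lt R (one_lt_card Fq)
  exact (finite_norm_lt_pow hA hC n).subset fun a ha => lt_of_le_of_lt ha hn

theorem exists_forall_eq_add_mul (hA : IsRingOfFunctionsAwayFrom Fq A O)
    (hC : IsCInfty Fq C O) {t : A} (ht : 1 < ‖algebraMap A C t‖) :
    ∃ R : ℝ, ∀ a : A, ∃ s a' : A, a = s + t * a' ∧
      ‖algebraMap A C s‖ ≤ R ∧ ‖algebraMap A C s‖ ≤ ‖algebraMap A C a‖ := by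
  have : FaithfulSMul A C := FaithfulSMul.trans A K C
  obtain ⟨R, hR0, hR⟩ := exists_forall_exists_norm_mul_eq hA hC ht
  refine ⟨R, fun a => ?_⟩
  induction a using (wellFounded_lt_of_finite (finite_norm_le hA hC)).induction with
  | _ a ih =>
  rcases le_or_gt ‖algebraMap A C a‖ R with hle | hgt
  · exact ⟨a, 0, by simp, hle, le_rfl⟩
  obtain ⟨b, hb⟩ := hR a hgt
  have hb0 : t * b ≠ 0 := by
    intro h0
    rw [h0, map_zero, norm_zero] at hb
    exact (hb.symm ▸ hgt).not_ge hR0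
  obtain ⟨c, hc⟩ := exists_norm_sub_smul_lt_algebraMap hA hC hb0 hb.ge
  rw [hb] at hc
  obtain ⟨s, a', heq, hs, hsa⟩ := ih _ hc
  refine ⟨s, c • b + a', ?_, hs, hsa.trans hc.le⟩
  rw [mul_add, mul_smul_comm, add_left_comm, ← heq, add_sub_cancel]

end Ultrametric

end Curve

theorem norm_lt_of_eq_add_mul {A C : Type*} [CommRing A] [NormedField C]
    [IsUltrametricDist C] [Algebra A C] {t a s a' : A} (ht : 1 < ‖algebraMap A C t‖)
    (ha : 0 < ‖algebraMap A C a‖) (heq : a = s + t * a')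
    (hs : ‖algebraMap A C s‖ ≤ ‖algebraMap A C a‖) : ‖algebraMap A C a'‖ < ‖algebraMap A C a‖ := by
  have hmul : ‖algebraMap A C t‖ * ‖algebraMap A C a'‖ ≤ ‖algebraMap A C a‖ := by
    rw [← norm_mul, ← map_mul, ← sub_eq_iff_eq_add'.2 heq, map_sub]
    exact norm_sub_le_of_norm_le le_rfl hs
  by_contra! hle
  nlinarith

section Finiteness

variable {Fq A K C : Type*} [Field Fq] [Fintype Fq] [CommRing A] [Field K] [NormedField C]
  [CompleteSpace C] [IsUltrametricDist C] [Algebra Fq A] [Algebra Fq K] [Algebra Fq C]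
  [Algebra A K] [Algebra A C] [Algebra K C] [IsScalarTower Fq A K] [IsScalarTower Fq A C]
  [IsScalarTower A K C] [IsFractionRing A K] {O : ValuationSubring K}

theorem finiteType (hA : IsRingOfFunctionsAwayFrom Fq A O) (hC : IsCInfty Fq C O) :
    Algebra.FiniteType Fq A := by
  classical
  obtain ⟨t, ht⟩ := exists_one_lt_norm hA hC
  obtain ⟨R, hR⟩ := exists_forall_eq_add_mul hA hC ht
  have hfin := finite_norm_le hA hC (max R 0)
  set B := Algebra.adjoin Fq ((insert t hfin.toFinset : Finset A) : Set A)
  have hball : ∀ s : A, ‖algebraMap A C s‖ ≤ max R 0 → s ∈ B := fun s hs =>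
    Algebra.subset_adjoin (by simp only [Finset.coe_insert]; exact .inr (hfin.mem_toFinset.2 hs))
  have htB : t ∈ B := Algebra.subset_adjoin (by simp)
  refine ⟨⟨insert t hfin.toFinset, eq_top_iff.2 fun a _ => ?_⟩⟩
  induction a using (wellFounded_lt_of_finite (finite_norm_le hA hC)).induction with
  | _ a ih =>
  rcases le_or_gt ‖algebraMap A C a‖ (max R 0) with hle | hgt
  · exact hball a hle
  obtain ⟨s, a', heq, hs, hsa⟩ := hR a
  have hlt := norm_lt_of_eq_add_mul ht ((le_max_right _ _).trans_lt hgt) heq hsa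
  rw [heq]
  exact add_mem (hball s (hs.trans (le_max_left _ _))) (mul_mem htB (ih a' hlt trivial))

theorem finite_of_fg_of_le_torsion (hA : IsRingOfFunctionsAwayFrom Fq A O)
    (hC : IsCInfty Fq C O) {M : Type*} [AddCommGroup M] [Module A M] {N : Submodule A M}
    (hN : N.FG) (htors : N ≤ Submodule.torsion A M) : (N : Set M).Finite := by
  have : Nontrivial A := (algebraMap A K).domain_nontrivial
  induction N, hN using Submodule.fg_induction with
  | singleton x =>
    obtain ⟨t, ht⟩ := exists_one_lt_norm hA hC
    obtain ⟨⟨a, ha⟩, hax⟩ :=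
      (Submodule.mem_torsion_iff x).1 (htors (Submodule.mem_span_singleton_self x))
    have hax : a • x = 0 := hax
    have hta : 1 < ‖algebraMap A C (t * a)‖ := by
      rw [map_mul, norm_mul]
      exact one_lt_mul_of_lt_of_le ht (one_le_norm_of_ne_zero hA hC (nonZeroDivisors.ne_zero ha))
    obtain ⟨R, hR⟩ := exists_forall_eq_add_mul hA hC hta
    refine ((finite_norm_le hA hC R).image fun s => s • x).subset fun y hy => ?_
    obtain ⟨b, rfl⟩ := Submodule.mem_span_singleton.1 hy
    obtain ⟨s, a', heq, hs, -⟩ := hR b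
    exact ⟨s, hs, by rw [heq, add_smul, mul_right_comm, mul_smul _ a, hax, smul_zero, add_zero]⟩
  | sup N₁ N₂ _ _ h₁ h₂ =>
    rw [Submodule.coe_sup]
    exact (h₁ (le_sup_left.trans htors)).add (h₂ (le_sup_right.trans htors))

theorem finite_range_norm_le (hA : IsRingOfFunctionsAwayFrom Fq A O) (hC : IsCInfty Fq C O)
    {M : Type*} [AddCommGroup M] [Module A M] [Module.Finite A M] (g : M →ₗ[A] K) (R : ℝ) :
    {y ∈ Set.range g | ‖algebraMap K C y‖ ≤ R}.Finite := by
  obtain ⟨d, hd, hint⟩ := FractionalIdeal.isFractional_of_fg (S := nonZeroDivisors A)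
    (Module.Finite.fg_top.map g)
  have : Nontrivial A := (algebraMap A K).domain_nontrivial
  have hd0 : algebraMap A K d ≠ 0 := IsFractionRing.to_map_ne_zero_of_mem_nonZeroDivisors hd
  refine ((finite_norm_le hA hC (‖algebraMap A C d‖ * R)).image
    fun a => (algebraMap A K d)⁻¹ * algebraMap A K a).subset ?_
  rintro _ ⟨⟨x, rfl⟩, hx⟩
  obtain ⟨a, ha⟩ := hint (g x) ⟨x, trivial, rfl⟩
  rw [Algebra.smul_def] at ha
  refine ⟨a, ?_, (congrArg _ ha).trans (inv_mul_cancel_left₀ hd0 _)⟩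
  rw [Set.mem_ofPred_eq, IsScalarTower.algebraMap_apply A K C, ha, map_mul, norm_mul,
    ← IsScalarTower.algebraMap_apply]
  exact mul_le_mul_of_nonneg_left hx (norm_nonneg _)

theorem finite_norm_le_of_ker_le_torsion (hA : IsRingOfFunctionsAwayFrom Fq A O)
    (hC : IsCInfty Fq C O) {M : Type*} [AddCommGroup M] [Module A M] [Module.Finite A M]
    {g : M →ₗ[A] K} (hg : LinearMap.ker g ≤ Submodule.torsion A M) (R : ℝ) :
    {x : M | ‖algebraMap K C (g x)‖ ≤ R}.Finite := by
  have hft := finiteType hA hC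
  have : IsNoetherianRing A := Algebra.FiniteType.isNoetherianRing Fq A
  have hker := finite_of_fg_of_le_torsion hA hC (IsNoetherian.noetherian _) hg
  refine ((finite_range_norm_le hA hC g R).preimage' (f := g) ?_).subset
    fun x hx => ⟨⟨x, rfl⟩, hx⟩
  rintro _ ⟨⟨x, rfl⟩, -⟩
  refine (hker.image (· + x)).subset fun y hy => ⟨y - x, ?_, sub_add_cancel y x⟩
  exact LinearMap.sub_mem_ker_iff.2 hy

end Finiteness

section Diagonal

variable {Fq A K C : Type*} [Field Fq] [Fintype Fq] [CommRing A] [Field K] [NormedField C]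
  [CompleteSpace C] [IsUltrametricDist C] [Algebra Fq A] [Algebra Fq K] [Algebra Fq C]
  [Algebra A K] [Algebra A C] [Algebra K C] [IsScalarTower Fq A K] [IsScalarTower Fq A C]
  [IsScalarTower A K C] [FaithfulSMul A K] {O : ValuationSubring K}

theorem diagonal_mem_nonZeroDivisors (hA : IsRingOfFunctionsAwayFrom Fq A O)
    (hC : IsCInfty Fq C O) {t : A} (ht : 1 < ‖algebraMap A C t‖) :
    algebraMap A C t ⊗ₜ[Fq] (1 : A) - (1 : C) ⊗ₜ[Fq] t ∈ nonZeroDivisors (C ⊗[Fq] A) := by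
  have ht0 : 0 < ‖algebraMap A C t‖ := one_pos.trans ht
  let V : ℕ → Submodule Fq A := fun n =>
    { carrier := {a | ‖algebraMap A C a‖ < ‖algebraMap A C t‖ ^ n}
      zero_mem' := by
        rw [Set.mem_ofPred_eq, map_zero, norm_zero]
        exact pow_pos ht0 n
      add_mem' := fun {a b} ha hb => by
        rw [Set.mem_ofPred_eq, map_add]
        exact (IsUltrametricDist.norm_add_le_max _ _).trans_lt (max_lt ha hb)
      smul_mem' := fun c a ha => by
        rw [Set.mem_ofPred_eq, algebraMap.smul]
        exact (norm_smul_le' c _).trans_lt ha }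
  refine tmul_one_sub_one_tmul_mem_nonZeroDivisors _ (V := V) ?_ ?_ ?_ ?_
  · refine (Submodule.eq_bot_iff _).2 fun a ha => ?_
    by_contra! hne
    exact (one_le_norm_of_ne_zero hA hC hne).not_gt (by simpa [V] using ha)
  · exact fun m n hmn a ha => lt_of_lt_of_le ha (pow_le_pow_right₀ ht.le hmn)
  · exact fun a => pow_unbounded_of_one_lt _ ht
  · intro n a ha
    have ha : ‖algebraMap A C (t * a)‖ < ‖algebraMap A C t‖ ^ (n + 1) := ha
    rw [map_mul, norm_mul, pow_succ'] at ha
    exact lt_of_mul_lt_mul_left ha ht0.le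

end Diagonal

section Differentials

open IntermediateField Polynomial

variable {k K : Type*} [Field k] [Field K] [Algebra k K]

theorem exists_isSeparable_adjoin_singleton [PerfectField k]
    (hfg : (⊤ : IntermediateField k K).FG) (htr : Algebra.trdeg k K = 1) :
    ∃ t : K, Algebra.IsSeparable k⟮t⟯ K := by
  have : Algebra.EssFiniteType k (⊤ : IntermediateField k K) := essFiniteType_iff.2 hfg
  have : Algebra.EssFiniteType k K :=
    .of_surjective (topEquiv (F := k) (E := K)).toAlgHom topEquiv.surjective
  obtain ⟨s, hs, hsep⟩ := exists_isTranscendenceBasis_and_isSeparable_of_perfectField k K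
  have hcard := hs.cardinalMk_eq_trdeg
  rw [htr, Cardinal.mk_coe_finset, Nat.cast_eq_one, Finset.card_eq_one] at hcard
  obtain ⟨t, rfl⟩ := hcard
  exact ⟨t, by rwa [Finset.coe_singleton] at hsep⟩

variable (p : ℕ) [Fact p.Prime] [CharP K p]

theorem adjoin_fieldRange_frobenius_eq_top_of_isSeparable [PerfectField k] (s : Set K)
    [Algebra.IsSeparable (adjoin k s) K] : adjoin (frobenius K p).fieldRange s = ⊤ := by
  have : CharP k p := (RingHom.charP_iff (algebraMap k K) (algebraMap k K).injective p).2 ‹_›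
  set E := (frobenius K p).fieldRange
  have hE : ∀ x : K, x ^ p ∈ adjoin E s := fun x => (adjoin E s).algebraMap_mem ⟨x ^ p, x, rfl⟩
  have hk : Set.range (algebraMap k K) ⊆ (adjoin E s).toSubfield := by
    rintro _ ⟨c, rfl⟩
    obtain ⟨d, rfl⟩ := surjective_frobenius k p c
    rw [frobenius_def, map_pow]
    exact hE _
  have hks : (adjoin k s).toSubfield ≤ (adjoin E s).toSubfield :=
    adjoin_le_subfield k s hk (subset_adjoin E s)
  refine eq_top_iff.2 fun x _ => ?_
  have hx : x ∈ adjoin (adjoin k s) {x ^ p} := by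
    rw [← adjoin_simple_eq_adjoin_pow_expChar_of_isSeparable (adjoin k s) K
      (Algebra.IsSeparable.isSeparable _ x) p]
    exact mem_adjoin_simple_self _ x
  refine adjoin_le_subfield (K := (adjoin E s).toSubfield) (adjoin k s) _ ?_ ?_ hx
  · rintro _ ⟨y, rfl⟩
    exact hks y.2
  · rintro _ rfl
    exact hE x

theorem isIntegral_fieldRange_frobenius (x : K) : IsIntegral (frobenius K p).fieldRange x :=
  .of_pow (Nat.Prime.pos Fact.out)
    (isIntegral_algebraMap (x := (⟨x ^ p, x, rfl⟩ : (frobenius K p).fieldRange)))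

theorem natDegree_minpoly_fieldRange_frobenius_le (x : K) :
    (minpoly (frobenius K p).fieldRange x).natDegree ≤ p := by
  have hp : p.Prime := Fact.out
  have hmonic := monic_X_pow_sub_C (⟨x ^ p, x, rfl⟩ : (frobenius K p).fieldRange) hp.ne_zero
  refine (natDegree_le_of_dvd (minpoly.dvd _ x ?_) hmonic.ne_zero).trans_eq natDegree_X_pow_sub_C
  simp [Algebra.algebraMap_ofSubsemiring_apply]

theorem natDegree_minpoly_fieldRange_frobenius {x : K} (hx : ∀ c : K, c ^ p ≠ x) :
    (minpoly (frobenius K p).fieldRange x).natDegree = p := by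
  have hp : p.Prime := Fact.out
  have hirr : Irreducible (X ^ p - C (⟨x ^ p, x, rfl⟩ : (frobenius K p).fieldRange)) := by
    refine X_pow_sub_C_irreducible_of_prime hp ?_
    rintro ⟨_, c, rfl⟩ h
    exact hx c (frobenius_inj K p (congrArg Subtype.val h))
  rw [← minpoly.eq_of_irreducible_of_monic hirr
    (by simp [Algebra.algebraMap_ofSubsemiring_apply]) (monic_X_pow_sub_C _ hp.ne_zero)]
  exact natDegree_X_pow_sub_C

theorem adjoin_fieldRange_frobenius_singleton_eq_top [PerfectField k]
    (hfg : (⊤ : IntermediateField k K).FG) (htr : Algebra.trdeg k K = 1) {x : K}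
    (hx : ∀ c : K, c ^ p ≠ x) : adjoin (frobenius K p).fieldRange {x} = ⊤ := by
  obtain ⟨t, _⟩ := exists_isSeparable_adjoin_singleton hfg htr
  have htop := adjoin_fieldRange_frobenius_eq_top_of_isSeparable (k := k) p {t}
  set E := (frobenius K p).fieldRange
  have hfin : FiniteDimensional E (⊤ : IntermediateField E K) :=
    htop ▸ adjoin.finiteDimensional (isIntegral_fieldRange_frobenius p t)
  have : FiniteDimensional E K :=
    .of_surjective (topEquiv (F := E) (E := K)).toLinearMap topEquiv.surjective
  refine eq_of_le_of_finrank_le le_top ?_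
  rw [← htop, adjoin.finrank (isIntegral_fieldRange_frobenius p t),
    adjoin.finrank (isIntegral_fieldRange_frobenius p x),
    natDegree_minpoly_fieldRange_frobenius p hx]
  exact natDegree_minpoly_fieldRange_frobenius_le p t

theorem span_D_eq_top [PerfectField k] (hfg : (⊤ : IntermediateField k K).FG)
    (htr : Algebra.trdeg k K = 1) {x : K} (hx : ∀ c : K, c ^ p ≠ x) :
    Submodule.span K {KaehlerDifferential.D k K x} = ⊤ := by
  rw [eq_top_iff, ← KaehlerDifferential.span_range_derivation, Submodule.span_le]
  rintro _ ⟨y, rfl⟩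
  have hy : y ∈ adjoin (frobenius K p).fieldRange {x} := by
    rw [adjoin_fieldRange_frobenius_singleton_eq_top p hfg htr hx]
    exact mem_top
  change KaehlerDifferential.D k K y ∈ Submodule.span K {KaehlerDifferential.D k K x}
  induction hy using adjoin_induction with
  | mem y hy => rw [Set.mem_singleton_iff.1 hy]; exact Submodule.mem_span_singleton_self _
  | algebraMap y =>
    obtain ⟨_, c, rfl⟩ := y
    have hpow : KaehlerDifferential.D k K (c ^ p) = 0 := by
      rw [Derivation.leibniz_pow, ← Nat.cast_smul_eq_nsmul K, CharP.cast_eq_zero, zero_smul]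
    change KaehlerDifferential.D k K (c ^ p) ∈ _
    rw [hpow]
    exact zero_mem _
  | add y z _ _ hy hz => rw [map_add]; exact add_mem hy hz
  | inv y _ hy => rw [Derivation.leibniz_inv]; exact Submodule.smul_mem _ _ hy
  | mul y z _ _ hy hz =>
    rw [Derivation.leibniz]
    exact add_mem (Submodule.smul_mem _ _ hz) (Submodule.smul_mem _ _ hy)

end Differentials

section Uniformizer

variable {Fq A K C : Type*} [Field Fq] [Fintype Fq] [Field K] [NormedField C]
  [CompleteSpace C] [Algebra K C] {O : ValuationSubring K}

theorem pow_ne_of_norm_eq_inv_card (hC : IsCInfty Fq C O) {π : K}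
    (hπ : ‖algebraMap K C π‖ = (Fintype.card Fq : ℝ)⁻¹) {p : ℕ} (hp : p ≠ 1) (c : K) :
    c ^ p ≠ π := by
  rintro rfl
  have hq := one_lt_card Fq
  have hc0 : algebraMap K C c ^ p ≠ 0 := by
    rw [← map_pow, ← norm_pos_iff, hπ]
    positivity
  rcases eq_or_ne c 0 with rfl | hc
  · obtain rfl : p = 0 := by
      by_contra hp0
      exact hc0 (by rw [map_zero, zero_pow hp0])
    rw [pow_zero, map_one, norm_one] at hπ
    exact hq.ne (by rw [← inv_inv (Fintype.card Fq : ℝ), ← hπ, inv_one])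
  · obtain ⟨n, hn⟩ := hC.norm_eq_zpow c hc
    rw [map_pow, norm_pow, hn, ← zpow_natCast, ← zpow_mul, ← zpow_neg_one] at hπ
    have hdvd : (p : ℤ) ∣ 1 :=
      ⟨-n, by linarith [zpow_right_injective₀ (zero_lt_one.trans hq) hq.ne' hπ]⟩
    exact hp (by exact_mod_cast Int.eq_one_of_dvd_one p.cast_nonneg hdvd)

theorem span_D_uniformizer_eq_top [CommRing A] [Algebra Fq K] [Algebra A K]
    (hA : IsRingOfFunctionsAwayFrom Fq A O) (hC : IsCInfty Fq C O)
    {π : K} (hπ : ‖algebraMap K C π‖ = (Fintype.card Fq : ℝ)⁻¹) :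
    Submodule.span K {KaehlerDifferential.D Fq K π} = ⊤ := by
  obtain ⟨p, hp⟩ := CharP.exists Fq
  have : CharP K p := (RingHom.charP_iff (algebraMap Fq K) (algebraMap Fq K).injective p).1 hp
  have hprime : p.Prime := CharP.char_is_prime Fq p
  have : Fact p.Prime := ⟨hprime⟩
  exact span_D_eq_top p hA.fg hA.trdeg_eq_one (pow_ne_of_norm_eq_inv_card hC hπ hprime.ne_one)

end Uniformizer

theorem norm_zpow_of_norm_eq_inv {E : Type*} [NormedDivisionRing E] {x : E} {a : ℝ}
    (hx : ‖x‖ = a⁻¹) (n : ℤ) : ‖x ^ n‖ = a ^ (-n) := by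
  rw [norm_zpow, hx, inv_zpow']

theorem tendsto_zpow_neg_add_nat {a : ℝ} (ha : 1 < a) (n : ℤ) :
    Filter.Tendsto (fun k : ℕ => a ^ (-(n + k))) Filter.atTop (nhds 0) := by
  have h := (tendsto_pow_atTop_nhds_zero_of_lt_one (by positivity)
    (inv_lt_one_of_one_lt₀ ha)).const_mul (a ^ (-n))
  rw [mul_zero] at h
  refine h.congr fun k => ?_
  rw [neg_add, zpow_add₀ (by positivity), zpow_neg _ (k : ℤ), zpow_natCast, inv_pow]

section Residues

variable {Fq C : Type*} [Field Fq] [NormedField C] [Algebra Fq C]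

/-- `r` is a coefficient of `ϖ⁻¹` in a Laurent expansion `x = ∑ c_n ϖ ^ n`.  This is the relation
underlying `IsResidue`; stated as a relation it needs no uniqueness of expansions. -/
def HasResidue (ϖ x : C) (r : Fq) : Prop :=
  ∃ c : ℤ → Fq, HasSum (fun n : ℤ => c n • ϖ ^ n) x ∧ c (-1) = r

variable {ϖ x y : C} {r s : Fq}

theorem HasResidue.add (hx : HasResidue ϖ x r) (hy : HasResidue ϖ y s) :
    HasResidue ϖ (x + y) (r + s) := by
  obtain ⟨c, hc, rfl⟩ := hx
  obtain ⟨d, hd, rfl⟩ := hy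
  exact ⟨c + d, by simpa only [Pi.add_apply, add_smul] using hc.add hd, rfl⟩

theorem HasResidue.smul (k : Fq) (hx : HasResidue ϖ x r) : HasResidue ϖ (k • x) (k * r) := by
  obtain ⟨c, hc, rfl⟩ := hx
  refine ⟨k • c, ?_, rfl⟩
  simpa only [← Algebra.smul_def, Pi.smul_apply, smul_assoc] using
    hc.mul_left (algebraMap Fq C k)

end Residues

section Expansions

variable {Fq K C : Type*} [Field Fq] [Fintype Fq] [Field K] [NormedField C] [CompleteSpace C]
  [IsUltrametricDist C] [Algebra K C] {O : ValuationSubring K}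
  [Algebra Fq K] [Algebra Fq C] [IsScalarTower Fq K C] {A : Type*} [CommRing A] [Algebra A K]
  {ϖ x : C}

theorem exists_norm_sub_smul_zpow_le (hA : IsRingOfFunctionsAwayFrom Fq A O)
    (hC : IsCInfty Fq C O) (hϖK : ϖ ∈ kInfty K C) (hϖ : ‖ϖ‖ = (Fintype.card Fq : ℝ)⁻¹)
    (hx : x ∈ kInfty K C) {n : ℤ} (hxn : ‖x‖ ≤ (Fintype.card Fq : ℝ) ^ (-n)) :
    ∃ c : Fq, ‖x - c • ϖ ^ n‖ ≤ (Fintype.card Fq : ℝ) ^ (-(n + 1)) := by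
  have hnorm := norm_zpow_of_norm_eq_inv hϖ n
  have hne : ϖ ^ n ≠ 0 := norm_pos_iff.1 (by rw [hnorm]; positivity)
  have hmem := zpow_mem hϖK n
  obtain ⟨c, hc⟩ := exists_norm_sub_smul_lt hA hC hx hmem hne (hxn.trans_eq hnorm.symm)
  refine ⟨c, norm_le_zpow_of_norm_lt_zpow hC (sub_mem hx (smul_mem_kInfty c hmem)) ?_⟩
  rwa [neg_add, neg_add_cancel_right, ← hnorm]

theorem exists_forall_norm_sub_sum_le (hA : IsRingOfFunctionsAwayFrom Fq A O)
    (hC : IsCInfty Fq C O) (hϖK : ϖ ∈ kInfty K C) (hϖ : ‖ϖ‖ = (Fintype.card Fq : ℝ)⁻¹)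
    (hx : x ∈ kInfty K C) {n : ℤ} (hxn : ‖x‖ ≤ (Fintype.card Fq : ℝ) ^ (-n)) :
    ∃ e : ℕ → Fq, ∀ k : ℕ, ‖x - ∑ i ∈ Finset.range k, e i • ϖ ^ (n + i)‖ ≤
      (Fintype.card Fq : ℝ) ^ (-(n + k)) := by
  choose! digit hdigit using fun (m : ℤ) (y : C)
    (hy : y ∈ kInfty K C ∧ ‖y‖ ≤ (Fintype.card Fq : ℝ) ^ (-m)) =>
      exists_norm_sub_smul_zpow_le hA hC hϖK hϖ hy.1 hy.2
  let remainder : ℕ → C := fun k => k.rec x fun i y => y - digit (n + i) y • ϖ ^ (n + i)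
  have hremainder : ∀ k, remainder k ∈ kInfty K C ∧
      ‖remainder k‖ ≤ (Fintype.card Fq : ℝ) ^ (-(n + k)) := fun k => by
    induction k with
    | zero => exact ⟨hx, by simpa [remainder] using hxn⟩
    | succ k ih =>
      refine ⟨sub_mem ih.1 (smul_mem_kInfty _ (zpow_mem hϖK _)), ?_⟩
      rw [Nat.cast_succ, ← add_assoc]
      exact hdigit _ _ ih
  refine ⟨fun i => digit (n + i) (remainder i), fun k => ?_⟩
  suffices hsum : x - ∑ i ∈ Finset.range k, digit (n + i) (remainder i) • ϖ ^ (n + i) =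
      remainder k from hsum ▸ (hremainder k).2
  induction k with
  | zero => simp [remainder]
  | succ k ih => rw [Finset.sum_range_succ, ← sub_sub, ih]

theorem exists_hasSum_smul_zpow (hA : IsRingOfFunctionsAwayFrom Fq A O) (hC : IsCInfty Fq C O)
    (hϖK : ϖ ∈ kInfty K C) (hϖ : ‖ϖ‖ = (Fintype.card Fq : ℝ)⁻¹) (hx : x ∈ kInfty K C) {n : ℤ}
    (hxn : ‖x‖ ≤ (Fintype.card Fq : ℝ) ^ (-n)) :
    ∃ c : ℤ → Fq, HasSum (fun i : ℤ => c i • ϖ ^ i) x ∧ ∀ i < n, c i = 0 := by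
  obtain ⟨e, he⟩ := exists_forall_norm_sub_sum_le hA hC hϖK hϖ hx hxn
  have hlim := tendsto_zpow_neg_add_nat (one_lt_card Fq) n
  have hterm : Filter.Tendsto (fun k : ℕ => e k • ϖ ^ (n + k)) Filter.cofinite (nhds 0) := by
    rw [Nat.cofinite_eq_atTop]
    refine squeeze_zero_norm (fun k => (norm_smul_le' _ _).trans_eq ?_) hlim
    exact norm_zpow_of_norm_eq_inv hϖ _
  have hsum : HasSum (fun k : ℕ => e k • ϖ ^ (n + k)) x := by
    rw [(NonarchimedeanAddGroup.summable_of_tendsto_cofinite_zero hterm).hasSum_iff_tendsto_nat]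
    simpa using (squeeze_zero_norm he hlim).const_sub x
  have hinj : Function.Injective fun k : ℕ => n + (k : ℤ) := fun i k h => by simpa using h
  have hzero : ∀ i ∉ Set.range fun k : ℕ => n + (k : ℤ),
      Function.extend (fun k : ℕ => n + (k : ℤ)) e 0 i = 0 := fun i hi =>
    Function.extend_apply' _ _ _ hi
  refine ⟨Function.extend (fun k : ℕ => n + (k : ℤ)) e 0, ?_, fun i hi => hzero i ?_⟩
  · rw [← hinj.hasSum_iff fun i hi => by rw [hzero i hi, zero_smul]]
    simpa only [Function.comp_def, hinj.extend_apply] using hsum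
  · rintro ⟨k, rfl⟩
    exact hi.not_ge (le_add_of_nonneg_right k.cast_nonneg)

theorem exists_hasResidue (hA : IsRingOfFunctionsAwayFrom Fq A O) (hC : IsCInfty Fq C O)
    (hϖK : ϖ ∈ kInfty K C) (hϖ : ‖ϖ‖ = (Fintype.card Fq : ℝ)⁻¹) (hx : x ∈ kInfty K C) :
    ∃ r : Fq, HasResidue ϖ x r := by
  obtain ⟨n, hn⟩ := pow_unbounded_of_one_lt ‖x‖ (one_lt_card Fq)
  obtain ⟨c, hc, -⟩ := exists_hasSum_smul_zpow hA hC hϖK hϖ hx (n := -n) (by simpa using hn.le)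
  exact ⟨c (-1), c, hc, rfl⟩

theorem hasResidue_zero_of_norm_le_one (hA : IsRingOfFunctionsAwayFrom Fq A O)
    (hC : IsCInfty Fq C O) (hϖK : ϖ ∈ kInfty K C) (hϖ : ‖ϖ‖ = (Fintype.card Fq : ℝ)⁻¹)
    (hx : x ∈ kInfty K C) (h : ‖x‖ ≤ 1) : HasResidue ϖ x (0 : Fq) := by
  obtain ⟨c, hc, hc0⟩ := exists_hasSum_smul_zpow hA hC hϖK hϖ hx (n := 0) (by simpa using h)
  exact ⟨c, hc, hc0 _ (by simp)⟩

theorem exists_hasResidue_ne_zero (hA : IsRingOfFunctionsAwayFrom Fq A O) (hC : IsCInfty Fq C O)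
    (hϖK : ϖ ∈ kInfty K C) (hϖ : ‖ϖ‖ = (Fintype.card Fq : ℝ)⁻¹) (hx : x ∈ kInfty K C)
    (h : ‖x‖ = Fintype.card Fq) : ∃ r : Fq, r ≠ 0 ∧ HasResidue ϖ x r := by
  have hq := one_lt_card Fq
  obtain ⟨c, hc, hc0⟩ := exists_hasSum_smul_zpow hA hC hϖK hϖ hx (n := -1) (by simp [h])
  refine ⟨c (-1), fun hzero => ?_, c, hc, rfl⟩
  have hle : ‖x‖ ≤ 1 := by
    rw [← hc.tsum_eq]
    refine IsUltrametricDist.norm_tsum_le_of_forall_le_of_nonneg zero_le_one fun i => ?_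
    rcases le_or_gt i (-1) with hi | hi
    · rw [hi.eq_or_lt.elim (fun h => h ▸ hzero) (hc0 i), zero_smul, norm_zero]
      exact zero_le_one
    · refine (norm_smul_le' _ _).trans ?_
      rw [norm_zpow_of_norm_eq_inv hϖ]
      exact zpow_le_one_of_nonpos₀ hq.le (by omega)
  exact hq.not_ge (h ▸ hle)

end Expansions

section ResiduePairing

variable {Fq K C : Type*} [Field Fq] [Fintype Fq] [Field K] [NormedField C] [CompleteSpace C]
  [IsUltrametricDist C] [Algebra K C] {O : ValuationSubring K}
  [Algebra Fq K] [Algebra Fq C] [IsScalarTower Fq K C] {A : Type*} [CommRing A] [Algebra A K]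
  {ϖ : C} {M : Type*} [AddCommGroup M] [Module Fq M] {g : M →ₗ[Fq] C}

theorem forall_hasResidue_mul_of_norm_lt (hA : IsRingOfFunctionsAwayFrom Fq A O)
    (hC : IsCInfty Fq C O) (hg : ∀ m, g m ∈ kInfty K C) (χ : Module.Dual Fq M) {b : C} {m₀ : M}
    (hm₀ : g m₀ ≠ 0) (hlow : ∀ m, ‖g m‖ < ‖g m₀‖ → HasResidue ϖ (b * g m) (χ m))
    (htop : HasResidue ϖ (b * g m₀) (χ m₀)) (m : M) (hm : ‖g m‖ ≤ ‖g m₀‖) :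
    HasResidue ϖ (b * g m) (χ m) := by
  obtain ⟨c, hc⟩ := exists_norm_sub_smul_lt hA hC (hg m) (hg m₀) hm₀ hm
  rw [← map_smul, ← map_sub] at hc
  convert (hlow _ hc).add (htop.smul c) using 1
  · rw [map_sub, map_smul, mul_sub, mul_smul_comm, sub_add_cancel]
  · rw [map_sub, map_smul, smul_eq_mul, sub_add_cancel]

theorem exists_forall_hasResidue_mul_succ (hA : IsRingOfFunctionsAwayFrom Fq A O)
    (hC : IsCInfty Fq C O) (hϖK : ϖ ∈ kInfty K C) (hϖ : ‖ϖ‖ = (Fintype.card Fq : ℝ)⁻¹)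
    (hg : ∀ m, g m ∈ kInfty K C) (χ : Module.Dual Fq M) {n : ℤ} {b : C} (hb : b ∈ kInfty K C)
    (h : ∀ m, ‖g m‖ ≤ (Fintype.card Fq : ℝ) ^ n → HasResidue ϖ (b * g m) (χ m)) :
    ∃ b' ∈ kInfty K C, ‖b' - b‖ ≤ (Fintype.card Fq : ℝ) ^ (-n) ∧
      ∀ m, ‖g m‖ ≤ (Fintype.card Fq : ℝ) ^ (n + 1) → HasResidue ϖ (b' * g m) (χ m) := by
  by_cases hex : ∃ m₀, ‖g m₀‖ = (Fintype.card Fq : ℝ) ^ (n + 1)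
  · obtain ⟨m₀, hm₀⟩ := hex
    have hnorm : ‖ϖ ^ n‖ = (Fintype.card Fq : ℝ) ^ (-n) := norm_zpow_of_norm_eq_inv hϖ n
    have hmul : ∀ m, ϖ ^ n * g m ∈ kInfty K C := fun m => mul_mem (zpow_mem hϖK n) (hg m)
    obtain ⟨r, hr0, hr⟩ := exists_hasResidue_ne_zero hA hC hϖK hϖ (hmul m₀) (by
      rw [norm_mul, hnorm, hm₀, ← zpow_add₀ (by positivity), neg_add_cancel_left, zpow_one])
    obtain ⟨s, hs⟩ := exists_hasResidue hA hC hϖK hϖ (mul_mem hb (hg m₀))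
    set β : Fq := (χ m₀ - s) / r
    have hβ : ∀ m, (b + β • ϖ ^ n) * g m = b * g m + β • (ϖ ^ n * g m) := fun m => by
      rw [add_mul, smul_mul_assoc]
    have hg0 : g m₀ ≠ 0 := norm_pos_iff.1 (by rw [hm₀]; positivity)
    refine ⟨b + β • ϖ ^ n, add_mem hb (smul_mem_kInfty β (zpow_mem hϖK n)), ?_, ?_⟩
    · rw [add_sub_cancel_left]
      exact (norm_smul_le' _ _).trans_eq hnorm
    rw [← hm₀]
    refine forall_hasResidue_mul_of_norm_lt hA hC hg χ hg0 (fun m hm => ?_) ?_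
    · have hmn := norm_le_zpow_of_norm_lt_zpow hC (hg m) (hm₀ ▸ hm)
      have hsmall : ‖ϖ ^ n * g m‖ ≤ 1 := by
        rw [norm_mul, hnorm, zpow_neg]
        exact inv_mul_le_one_of_le₀ hmn (by positivity)
      have hres := (h m hmn).add
        ((hasResidue_zero_of_norm_le_one hA hC hϖK hϖ (hmul m) hsmall).smul β)
      rwa [mul_zero, add_zero, ← hβ] at hres
    · have hres := hs.add (hr.smul β)
      rwa [div_mul_cancel₀ _ hr0, add_sub_cancel, ← hβ] at hres
  · push Not at hex
    refine ⟨b, hb, by rw [sub_self, norm_zero]; positivity, fun m hm => h m ?_⟩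
    exact norm_le_zpow_of_norm_lt_zpow hC (hg m) (hm.lt_of_ne (hex m))

theorem exists_forall_hasResidue_mul (hA : IsRingOfFunctionsAwayFrom Fq A O)
    (hC : IsCInfty Fq C O) (hϖK : ϖ ∈ kInfty K C) (hϖ : ‖ϖ‖ = (Fintype.card Fq : ℝ)⁻¹)
    (hg : ∀ m, g m ∈ kInfty K C) (χ : Module.Dual Fq M) (n : ℤ)
    (hχ : ∀ m, ‖g m‖ ≤ (Fintype.card Fq : ℝ) ^ n → χ m = 0) :
    ∃ b ∈ kInfty K C, ‖b‖ ≤ (Fintype.card Fq : ℝ) ^ (-n) ∧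
      ∀ m, HasResidue ϖ (b * g m) (χ m) := by
  have hq := one_lt_card Fq
  choose! next hnext using fun (k : ℕ) (b : C)
    (hb : b ∈ kInfty K C ∧ ∀ m, ‖g m‖ ≤ (Fintype.card Fq : ℝ) ^ (n + k) →
      HasResidue ϖ (b * g m) (χ m)) =>
    exists_forall_hasResidue_mul_succ hA hC hϖK hϖ hg χ hb.1 hb.2
  let b : ℕ → C := fun k => k.rec 0 next
  have hb : ∀ k : ℕ, b k ∈ kInfty K C ∧ ∀ m, ‖g m‖ ≤ (Fintype.card Fq : ℝ) ^ (n + k) →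
      HasResidue ϖ (b k * g m) (χ m) := fun k => by
    induction k with
    | zero =>
      refine ⟨zero_mem _, fun m hm => ?_⟩
      have hzero := hasResidue_zero_of_norm_le_one hA hC hϖK hϖ (zero_mem _) (by simp)
      simpa [b, hχ m (by simpa using hm)] using hzero
    | succ k ih =>
      rw [Nat.cast_succ, ← add_assoc]
      exact ⟨(hnext k _ ih).1, (hnext k _ ih).2.2⟩
  obtain ⟨β, hlim, hβ⟩ := exists_tendsto_forall_norm_sub_le (x := b)
    (fun k l hkl => zpow_le_zpow_right₀ hq.le (by omega)) (tendsto_zpow_neg_add_nat hq n)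
    fun k => (hnext k (b k) (hb k)).2.1
  have hβK : β ∈ kInfty K C := isClosed_kInfty.mem_of_tendsto hlim (.of_forall fun k => (hb k).1)
  refine ⟨β, hβK, by simpa [b] using hβ 0, fun m => ?_⟩
  obtain ⟨k, hk⟩ : ∃ k : ℕ, ‖g m‖ ≤ (Fintype.card Fq : ℝ) ^ (n + k) := by
    obtain ⟨k, hk⟩ := pow_unbounded_of_one_lt (‖g m‖ / (Fintype.card Fq : ℝ) ^ n) hq
    refine ⟨k, ?_⟩
    rw [zpow_add₀ (by positivity), zpow_natCast]
    exact ((div_lt_iff₀' (by positivity)).1 hk).le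
  have hsmall : ‖(β - b k) * g m‖ ≤ 1 := by
    rw [norm_mul]
    refine (mul_le_mul (hβ k) hk (norm_nonneg _) (by positivity)).trans_eq ?_
    rw [← zpow_add₀ (by positivity), neg_add_cancel, zpow_zero]
  have hres := ((hb k).2 m hk).add (hasResidue_zero_of_norm_le_one hA hC hϖK hϖ
    (mul_mem (sub_mem hβK (hb k).1) (hg m)) hsmall)
  rwa [← add_mul, add_sub_cancel, add_zero] at hres

end ResiduePairing

section LatticeBall

variable {A C : Type*} [CommRing A] [NormedField C] [Algebra A C] {Λ : Submodule A C}

/-- The lattice points of norm at most `R`, zero included. -/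
noncomputable def latticeBall (hΛ : IsLocallyFinite Λ) (R : ℝ) : Finset C :=
  (hΛ R).toFinset

theorem mem_latticeBall (hΛ : IsLocallyFinite Λ) {R : ℝ} {x : C} :
    x ∈ latticeBall hΛ R ↔ x ∈ Λ ∧ ‖x‖ ≤ R := by
  simp [latticeBall]

theorem zero_mem_latticeBall (hΛ : IsLocallyFinite Λ) {R : ℝ} (hR : 0 ≤ R) :
    (0 : C) ∈ latticeBall hΛ R :=
  (mem_latticeBall hΛ).2 ⟨zero_mem Λ, by rwa [norm_zero]⟩

theorem smul_mem_latticeBall (hΛ : IsLocallyFinite Λ) {R : ℝ} {x : C} (t : A)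
    (hx : x ∈ latticeBall hΛ R) : t • x ∈ latticeBall hΛ (‖algebraMap A C t‖ * R) := by
  rw [mem_latticeBall] at hx ⊢
  refine ⟨Λ.smul_mem t hx.1, ?_⟩
  rw [Algebra.smul_def, norm_mul]
  exact mul_le_mul_of_nonneg_left hx.2 (norm_nonneg _)

theorem exists_mem_forall_ne_smul (hΛ : IsLocallyFinite Λ) (h0 : Λ ≠ ⊥) {t : A}
    (ht : 1 < ‖algebraMap A C t‖) : ∃ μ ∈ Λ, ∀ x ∈ Λ, μ ≠ t • x := by
  obtain ⟨y, hy, hy0⟩ := Submodule.exists_mem_ne_zero_of_ne_bot h0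
  have hfin : {x : C | x ∈ Λ ∧ ‖x‖ ≤ ‖y‖ ∧ x ≠ 0}.Finite :=
    (hΛ ‖y‖).subset fun x hx => ⟨hx.1, hx.2.1⟩
  obtain ⟨μ, ⟨hμ, hμy, hμ0⟩, hmin⟩ :=
    Set.exists_min_image _ (fun x => ‖x‖) hfin ⟨y, hy, le_rfl, hy0⟩
  refine ⟨μ, hμ, fun x hx hμx => ?_⟩
  have hx0 : x ≠ 0 := by rintro rfl; exact hμ0 (by rw [hμx, smul_zero])
  have hlt : ‖x‖ < ‖μ‖ := by
    rw [hμx, Algebra.smul_def, norm_mul]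
    exact lt_mul_of_one_lt_left (norm_pos_iff.2 hx0) ht
  exact hlt.not_ge (hmin x ⟨hx, hlt.le.trans hμy, hx0⟩)

variable [IsUltrametricDist C]

theorem sub_mem_latticeBall (hΛ : IsLocallyFinite Λ) {R : ℝ} {x y : C}
    (hx : x ∈ latticeBall hΛ R) (hy : y ∈ latticeBall hΛ R) : x - y ∈ latticeBall hΛ R := by
  rw [mem_latticeBall] at *
  exact ⟨sub_mem hx.1 hy.1, norm_sub_le_of_norm_le hx.2 hy.2⟩

theorem exists_two_mul_card_latticeBall_le (hΛ : IsLocallyFinite Λ) (h0 : Λ ≠ ⊥) {t : A}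
    (ht : 1 < ‖algebraMap A C t‖) : ∃ R₀ : ℝ, 0 ≤ R₀ ∧ ∀ R ≥ R₀,
      2 * (latticeBall hΛ R).card ≤ (latticeBall hΛ (‖algebraMap A C t‖ * R)).card := by
  classical
  obtain ⟨μ, hμ, hne⟩ := exists_mem_forall_ne_smul hΛ h0 ht
  refine ⟨‖μ‖, norm_nonneg μ, fun R hR => ?_⟩
  have hR0 : 0 ≤ R := (norm_nonneg μ).trans hR
  have hμR : μ ∈ latticeBall hΛ (‖algebraMap A C t‖ * R) :=
    (mem_latticeBall hΛ).2 ⟨hμ, hR.le.trans (le_mul_of_one_le_left hR0 ht.le)⟩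
  have ht0 : algebraMap A C t ≠ 0 := norm_pos_iff.1 (one_pos.trans ht)
  have hinj : Function.Injective fun x : C => t • x := fun x y h => by
    simpa [Algebra.smul_def, ht0] using h
  have hinj' : Function.Injective fun x : C => μ - t • x := sub_right_injective.comp hinj
  have hdisj : Disjoint ((latticeBall hΛ R).image fun x => t • x)
      ((latticeBall hΛ R).image fun x => μ - t • x) := by
    simp only [Finset.disjoint_left, Finset.mem_image]
    rintro _ ⟨x, hx, rfl⟩ ⟨y, hy, hxy⟩
    refine hne (x + y) (add_mem ((mem_latticeBall hΛ).1 hx).1 ((mem_latticeBall hΛ).1 hy).1) ?_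
    rw [smul_add]
    exact sub_eq_iff_eq_add.1 hxy
  calc 2 * (latticeBall hΛ R).card
      = ((latticeBall hΛ R).image (fun x => t • x) ∪
          (latticeBall hΛ R).image fun x => μ - t • x).card := by
        rw [Finset.card_union_of_disjoint hdisj, Finset.card_image_of_injective _ hinj,
          Finset.card_image_of_injective _ hinj', two_mul]
    _ ≤ _ := Finset.card_le_card (Finset.union_subset
        (Finset.image_subset_iff.2 fun x hx => smul_mem_latticeBall hΛ t hx)
        (Finset.image_subset_iff.2 fun x hx =>
          sub_mem_latticeBall hΛ hμR (smul_mem_latticeBall hΛ t hx)))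

theorem exists_two_pow_mul_card_latticeBall_le (hΛ : IsLocallyFinite Λ) (h0 : Λ ≠ ⊥) {t : A}
    (ht : 1 < ‖algebraMap A C t‖) (k : ℕ) : ∃ R₀ : ℝ, ∀ R ≥ R₀,
      2 ^ k * (latticeBall hΛ R).card ≤ (latticeBall hΛ (‖algebraMap A C t‖ ^ k * R)).card := by
  obtain ⟨R₀, hR₀, hdouble⟩ := exists_two_mul_card_latticeBall_le hΛ h0 ht
  refine ⟨R₀, fun R hR => ?_⟩
  induction k with
  | zero => simp
  | succ k ih =>
    have hRk : R₀ ≤ ‖algebraMap A C t‖ ^ k * R :=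
      hR.le.trans (le_mul_of_one_le_left (hR₀.trans hR) (one_le_pow₀ ht.le))
    calc 2 ^ (k + 1) * (latticeBall hΛ R).card
        = 2 * (2 ^ k * (latticeBall hΛ R).card) := by ring
      _ ≤ 2 * (latticeBall hΛ (‖algebraMap A C t‖ ^ k * R)).card := Nat.mul_le_mul_left 2 ih
      _ ≤ (latticeBall hΛ (‖algebraMap A C t‖ * (‖algebraMap A C t‖ ^ k * R))).card :=
        hdouble _ hRk
      _ = (latticeBall hΛ (‖algebraMap A C t‖ ^ (k + 1) * R)).card := by
        rw [← mul_assoc, ← pow_succ']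

end LatticeBall

section TruncExp

open Polynomial

variable {F : Type*} [Field F]

theorem coeff_pow_one_of_coeff_zero_eq_zero {p : F[X]} (hp : p.coeff 0 = 0) (Q : ℕ) :
    (p ^ Q).coeff 1 = if Q = 1 then p.coeff 1 else 0 := by
  rcases lt_trichotomy Q 1 with hQ | rfl | hQ
  · obtain rfl : Q = 0 := by omega
    simp [coeff_one]
  · simp
  · rw [if_neg hQ.ne']
    exact X_pow_dvd_iff.1 (pow_dvd_pow_of_dvd (X_dvd_iff.2 hp) Q) 1 hQ

/-- The polynomial `x ∏ (1 - x / y)`, the product running over the nonzero `y ∈ V`: a truncation of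
the product defining `latticeExp`. If `0 ∈ V`, the corresponding factor is `1` because
`0⁻¹ = 0`. -/
noncomputable def truncExp (V : Finset F) : F[X] :=
  X * ∏ y ∈ V, (1 - C y⁻¹ * X)

theorem eval_truncExp (V : Finset F) (x : F) :
    (truncExp V).eval x = x * ∏ y ∈ V, (1 - x / y) := by
  simp only [truncExp, eval_mul, eval_X, eval_prod, eval_sub, eval_one, eval_C, div_eq_inv_mul]

theorem natDegree_truncExp_le (V : Finset F) : (truncExp V).natDegree ≤ V.card + 1 := by
  rw [add_comm]
  refine natDegree_mul_le.trans (Nat.add_le_add natDegree_X_le ?_)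
  refine (natDegree_prod_le _ _).trans ((Finset.sum_le_card_nsmul _ _ 1 fun y _ => ?_).trans_eq
    (by simp))
  refine (natDegree_sub_le _ _).trans (max_le (by simp) ?_)
  exact (natDegree_C_mul_le _ _).trans natDegree_X_le

theorem coeff_zero_truncExp (V : Finset F) : (truncExp V).coeff 0 = 0 := by
  simp [truncExp]

theorem coeff_one_truncExp (V : Finset F) : (truncExp V).coeff 1 = 1 := by
  rw [truncExp, coeff_X_mul, coeff_zero_eq_eval_zero, eval_prod]
  simp

theorem sum_truncExp_pow_mul_inv {U V : Finset F} (hV : ∀ x ∈ V, ∀ y ∈ V, x - y ∈ V) {Q : ℕ}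
    (hQ : Q ≠ 0) (hcard : Q * (U.card + 1) < V.card) (b : F) :
    ∑ x ∈ V, (truncExp U).eval (b * x) ^ Q * x⁻¹ = -(if Q = 1 then b else 0) := by
  set p : F[X] := (truncExp U).comp (C b * X) with hp
  have hp0 : p.coeff 0 = 0 := by rw [hp, comp_C_mul_X_coeff, coeff_zero_truncExp, zero_mul]
  have hp1 : p.coeff 1 = b := by
    rw [hp, comp_C_mul_X_coeff, coeff_one_truncExp, one_mul, pow_one]
  have hpdeg : p.natDegree ≤ U.card + 1 := by
    refine natDegree_comp_le.trans ?_
    calc (truncExp U).natDegree * (C b * X).natDegree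
        ≤ (U.card + 1) * 1 := Nat.mul_le_mul (natDegree_truncExp_le U)
          ((natDegree_C_mul_le _ _).trans natDegree_X_le)
      _ = U.card + 1 := mul_one _
  have hsum := sum_eval_mul_inv_eq_neg_coeff_one hV (G := p ^ Q)
    (by rw [coeff_zero_eq_eval_zero, eval_pow, ← coeff_zero_eq_eval_zero, hp0, zero_pow hQ])
    ((natDegree_pow_le.trans (Nat.mul_le_mul_left Q hpdeg)).trans_lt hcard)
  rw [coeff_pow_one_of_coeff_zero_eq_zero hp0, hp1] at hsum
  simpa [hp] using hsum

end TruncExp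

section LatticeExp

variable {A C : Type*} [CommRing A] [NormedField C] [Algebra A C] {Λ : Submodule A C}

/-- The nonzero lattice points of norm at most `R`, as a finite subset of the index type of the
product `latticeExp` and of the sum `universalZeta`. -/
noncomputable def nonzeroBall (hΛ : IsLocallyFinite Λ) (R : ℝ) : Finset {l : Λ // l ≠ 0} :=
  (latticeBall hΛ R).preimage (fun l => (l.1 : C))
    (Subtype.val_injective.comp Subtype.val_injective).injOn

theorem norm_le_of_mem_nonzeroBall (hΛ : IsLocallyFinite Λ) {R : ℝ} {l : {l : Λ // l ≠ 0}}
    (hl : l ∈ nonzeroBall hΛ R) : ‖(l.1 : C)‖ ≤ R :=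
  ((mem_latticeBall hΛ).1 (Finset.mem_preimage.1 hl)).2

theorem lt_norm_of_notMem_nonzeroBall (hΛ : IsLocallyFinite Λ) {R : ℝ} {l : {l : Λ // l ≠ 0}}
    (hl : l ∉ nonzeroBall hΛ R) : R < ‖(l.1 : C)‖ := by
  simpa [nonzeroBall, mem_latticeBall] using hl

@[to_additive]
theorem prod_nonzeroBall {M : Type*} [CommMonoid M] (hΛ : IsLocallyFinite Λ) (R : ℝ) {f : C → M}
    (hf : f 0 = 1) : ∏ l ∈ nonzeroBall hΛ R, f l.1 = ∏ x ∈ latticeBall hΛ R, f x := by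
  refine Finset.prod_preimage (fun l : {l : Λ // l ≠ 0} => (l.1 : C)) _ _ f fun x hx hrange => ?_
  obtain rfl : x = 0 := by
    by_contra hx0
    exact hrange ⟨⟨⟨x, ((mem_latticeBall hΛ).1 hx).1⟩, by simpa using hx0⟩, rfl⟩
  exact hf

theorem norm_sub_le_norm_left_mul {E : Type*} [NormedAddCommGroup E] [IsUltrametricDist E]
    {x y : E} {δ : ℝ} (hδ : δ < 1) (h : ‖x - y‖ ≤ ‖y‖ * δ) : ‖x - y‖ ≤ ‖x‖ * δ := by
  rcases eq_or_ne y 0 with rfl | hy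
  · simp_all
  · rwa [norm_eq_of_norm_sub_lt (h.trans_lt (mul_lt_of_lt_one_right (norm_pos_iff.2 hy) hδ))]

variable [CompleteSpace C] [IsUltrametricDist C]

theorem norm_latticeExp_sub_truncExp_le (hΛ : IsLocallyFinite Λ) {R : ℝ} {x : C} (hx : ‖x‖ < R) :
    ‖latticeExp Λ x - (truncExp (latticeBall hΛ R)).eval x‖ ≤ ‖latticeExp Λ x‖ * (‖x‖ / R) := by
  have hR : 0 < R := (norm_nonneg x).trans_lt hx
  have hlt : ‖x‖ / R < 1 := (div_lt_one hR).2 hx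
  have htend : Filter.Tendsto (fun l : {l : Λ // l ≠ 0} => x / (l.1 : C)) Filter.cofinite
      (nhds 0) := by
    simpa [div_eq_mul_inv] using (tendsto_inv_lattice hΛ).const_mul x
  have hprod := norm_tprod_one_sub_sub_prod_le htend (nonzeroBall hΛ R) (by positivity) hlt.le
    fun l hl => by
      rw [norm_div]
      gcongr
      exact (lt_norm_of_notMem_nonzeroBall hΛ hl).le
  rw [prod_nonzeroBall hΛ R (f := fun y => 1 - x / y) (by simp)] at hprod
  refine norm_sub_le_norm_left_mul hlt ?_
  rw [latticeExp, eval_truncExp, ← mul_sub, norm_mul, norm_mul, mul_assoc]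
  exact mul_le_mul_of_nonneg_left hprod (norm_nonneg x)

end LatticeExp

section LatticeSum

variable {A C : Type*} [CommRing A] [NormedField C] [Algebra A C] {Λ : Submodule A C} {b : C}
  {B R : ℝ}

theorem norm_latticeExp_pow_mul_inv_le (hB : ∀ l ∈ Λ, ‖latticeExp Λ (b * l)‖ ≤ B) (Q : ℕ)
    (l : {l : Λ // l ≠ 0}) :
    ‖latticeExp Λ (b * l.1) ^ Q * (l.1 : C)⁻¹‖ ≤ B ^ Q * ‖(l.1 : C)⁻¹‖ := by
  rw [norm_mul, norm_pow]
  gcongr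
  exact hB _ l.1.2

variable [CompleteSpace C] [IsUltrametricDist C]

theorem summable_latticeExp_pow_mul_inv (hΛ : IsLocallyFinite Λ)
    (hB : ∀ l ∈ Λ, ‖latticeExp Λ (b * l)‖ ≤ B) (Q : ℕ) :
    Summable fun l : {l : Λ // l ≠ 0} => latticeExp Λ (b * l.1) ^ Q * (l.1 : C)⁻¹ := by
  refine NonarchimedeanAddGroup.summable_of_tendsto_cofinite_zero ?_
  refine squeeze_zero_norm (norm_latticeExp_pow_mul_inv_le hB Q) ?_
  simpa using (tendsto_inv_lattice hΛ).norm.const_mul (B ^ Q)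

theorem norm_tsum_latticeExp_sub_sum_le (hΛ : IsLocallyFinite Λ)
    (hB : ∀ l ∈ Λ, ‖latticeExp Λ (b * l)‖ ≤ B) (Q : ℕ) (hR : 0 < R) :
    ‖∑' l : {l : Λ // l ≠ 0}, latticeExp Λ (b * l.1) ^ Q * (l.1 : C)⁻¹ -
      ∑ l ∈ nonzeroBall hΛ R, latticeExp Λ (b * l.1) ^ Q * (l.1 : C)⁻¹‖ ≤ B ^ Q / R := by
  have hB0 : 0 ≤ B := (norm_nonneg _).trans (hB 0 (zero_mem Λ))
  refine norm_tsum_sub_sum_le (summable_latticeExp_pow_mul_inv hΛ hB Q) _ (by positivity)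
    fun l hl => (norm_latticeExp_pow_mul_inv_le hB Q l).trans ?_
  rw [norm_inv, ← div_eq_mul_inv]
  gcongr
  exact (lt_norm_of_notMem_nonzeroBall hΛ hl).le

variable (Fq : Type*) [Field Fq] [Fintype Fq] [Algebra Fq C]

theorem sub_pow_card_pow {S : Type*} [CommRing S] [Algebra Fq S] (x y : S) (j : ℕ) :
    (x - y) ^ Fintype.card Fq ^ j = x ^ Fintype.card Fq ^ j - y ^ Fintype.card Fq ^ j := by
  have h := map_sub (FiniteField.frobeniusAlgHom Fq S ^ j) x y
  simpa [AlgHom.coe_pow, FiniteField.coe_frobeniusAlgHom, pow_iterate] using h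

theorem norm_latticeExp_pow_sub_truncExp_pow_le (hΛ : IsLocallyFinite Λ)
    (hB : ∀ l ∈ Λ, ‖latticeExp Λ (b * l)‖ ≤ B) (hb : ‖b‖ ≤ 1) (j : ℕ) {l : {l : Λ // l ≠ 0}}
    (hl : ‖b * (l.1 : C)‖ < R) :
    ‖latticeExp Λ (b * l.1) ^ Fintype.card Fq ^ j * (l.1 : C)⁻¹ -
      (truncExp (latticeBall hΛ R)).eval (b * (l.1 : C)) ^ Fintype.card Fq ^ j * (l.1 : C)⁻¹‖ ≤
      B ^ Fintype.card Fq ^ j / R := by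
  have hB0 : 0 ≤ B := (norm_nonneg _).trans (hB 0 (zero_mem Λ))
  have hR : 0 < R := (norm_nonneg _).trans_lt hl
  have hl0 : 0 < ‖(l.1 : C)‖ := norm_pos_iff.2 (by simpa using l.2)
  have hQ : Fintype.card Fq ^ j ≠ 0 := by positivity
  rw [← sub_mul, ← sub_pow_card_pow Fq, norm_mul, norm_pow, norm_inv]
  generalize Fintype.card Fq ^ j = Q at hQ ⊢
  calc _ ≤ (B * (‖b * (l.1 : C)‖ / R)) ^ Q * ‖(l.1 : C)‖⁻¹ := by
        gcongr
        refine (norm_latticeExp_sub_truncExp_le hΛ hl).trans ?_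
        gcongr
        exact hB _ l.1.2
    _ ≤ B ^ Q * (‖b * (l.1 : C)‖ / R) * ‖(l.1 : C)‖⁻¹ := by
        rw [mul_pow]
        gcongr
        exact pow_le_of_le_one (by positivity) ((div_le_one hR).2 hl.le) hQ
    _ = B ^ Q * ‖b‖ / R := by
        rw [norm_mul]
        field_simp
    _ ≤ B ^ Q / R := by
        gcongr
        exact mul_le_of_le_one_right (by positivity) hb

theorem norm_tsum_latticeExp_sub_le (hΛ : IsLocallyFinite Λ)
    (hB : ∀ l ∈ Λ, ‖latticeExp Λ (b * l)‖ ≤ B) {c : ℝ} (hc : 1 ≤ c) (hb : ‖b‖ * c < 1) (hR : 0 < R)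
    {j : ℕ} (hcard : Fintype.card Fq ^ j * ((latticeBall hΛ R).card + 1) <
      (latticeBall hΛ (c * R)).card) :
    ‖∑' l : {l : Λ // l ≠ 0}, latticeExp Λ (b * l.1) ^ Fintype.card Fq ^ j * (l.1 : C)⁻¹ -
      -(if j = 0 then b else 0)‖ ≤ B ^ Fintype.card Fq ^ j / R := by
  have hB0 : 0 ≤ B := (norm_nonneg _).trans (hB 0 (zero_mem Λ))
  have hb1 : ‖b‖ ≤ 1 := (le_mul_of_one_le_right (norm_nonneg b) hc).trans hb.le
  have hpoly := sum_truncExp_pow_mul_inv (fun x hx y hy => sub_mem_latticeBall hΛ hx hy)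
    (by positivity) hcard b
  rw [← sum_nonzeroBall hΛ (c * R) (by simp)] at hpoly
  have hQ : Fintype.card Fq ^ j = 1 ↔ j = 0 := by
    rw [Nat.pow_eq_one, or_iff_right Fintype.one_lt_card.ne']
  simp only [hQ] at hpoly
  rw [← hpoly, ← sub_add_sub_cancel _
    (∑ l ∈ nonzeroBall hΛ (c * R), latticeExp Λ (b * l.1) ^ Fintype.card Fq ^ j * (l.1 : C)⁻¹)]
  refine norm_add_le_of_norm_le ?_ ?_
  · refine (norm_tsum_latticeExp_sub_sum_le hΛ hB _ (by positivity)).trans ?_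
    gcongr
    exact le_mul_of_one_le_left hR.le hc
  · rw [← Finset.sum_sub_distrib]
    refine IsUltrametricDist.norm_sum_le_of_forall_le_of_nonneg (by positivity) fun l hl =>
      norm_latticeExp_pow_sub_truncExp_pow_le Fq hΛ hB hb1 j ?_
    calc ‖b * (l.1 : C)‖ ≤ ‖b‖ * (c * R) := by
          rw [norm_mul]
          gcongr
          exact norm_le_of_mem_nonzeroBall hΛ hl
      _ = ‖b‖ * c * R := by ring
      _ < R := mul_lt_of_lt_one_left hR hb

theorem exists_forall_tsum_latticeExp_eq (hΛ : IsLocallyFinite Λ) (h0 : Λ ≠ ⊥) {t : A}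
    (ht : 1 < ‖algebraMap A C t‖) (j : ℕ) : ∃ ε > 0, ∀ b : C, ‖b‖ < ε → ∀ B : ℝ,
      (∀ l ∈ Λ, ‖latticeExp Λ (b * l)‖ ≤ B) →
      ∑' l : {l : Λ // l ≠ 0}, latticeExp Λ (b * l.1) ^ Fintype.card Fq ^ j * (l.1 : C)⁻¹ =
        -(if j = 0 then b else 0) := by
  obtain ⟨k, hk⟩ := pow_unbounded_of_one_lt (2 * Fintype.card Fq ^ j) (one_lt_two (α := ℕ))
  obtain ⟨R₀, hgrowth⟩ := exists_two_pow_mul_card_latticeBall_le hΛ h0 ht k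
  have hc : 1 ≤ ‖algebraMap A C t‖ ^ k := one_le_pow₀ ht.le
  have hc0 : 0 < ‖algebraMap A C t‖ ^ k := one_pos.trans_le hc
  refine ⟨(‖algebraMap A C t‖ ^ k)⁻¹, by positivity, fun b hb B hB => ?_⟩
  have hbc : ‖b‖ * ‖algebraMap A C t‖ ^ k < 1 := by rwa [← lt_inv_mul_iff₀' hc0, mul_one]
  rw [← sub_eq_zero, ← norm_le_zero_iff]
  refine ge_of_tendsto (tendsto_const_nhds.div_atTop Filter.tendsto_id :
    Filter.Tendsto (fun R : ℝ => B ^ Fintype.card Fq ^ j / R) Filter.atTop (nhds 0)) ?_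
  filter_upwards [Filter.eventually_ge_atTop R₀, Filter.eventually_gt_atTop 0] with R hR hR0
  refine norm_tsum_latticeExp_sub_le Fq hΛ hB hc hbc hR0 ?_
  have hpos : 0 < (latticeBall hΛ R).card :=
    Finset.card_pos.2 ⟨0, zero_mem_latticeBall hΛ hR0.le⟩
  calc Fintype.card Fq ^ j * ((latticeBall hΛ R).card + 1)
      ≤ Fintype.card Fq ^ j * (2 * (latticeBall hΛ R).card) := Nat.mul_le_mul_left _ (by omega)
    _ = 2 * Fintype.card Fq ^ j * (latticeBall hΛ R).card := by ring
    _ < 2 ^ k * (latticeBall hΛ R).card := Nat.mul_lt_mul_of_pos_right hk hpos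
    _ ≤ _ := hgrowth R hR

end LatticeSum

section Pairing

variable {Fq C L ι κ : Type*} [Field Fq] [NormedField C] [Algebra Fq C]
  [AddCommGroup L] [Module Fq L] (b : Module.Basis ι Fq L) (v : κ → L) {u : κ → C}

theorem tsum_coord_smul_mul_eq (u : κ → C) (G : L →ₗ[Fq] C) (k : κ) :
    ∑' i, b.coord i (v k) • u k * G (b i) = G (v k) * u k := by
  conv_rhs => rw [← b.linearCombination_repr (v k), Finsupp.linearCombination_apply, Finsupp.sum,
    map_sum, Finset.sum_mul]
  rw [tsum_eq_sum (s := (b.repr (v k)).support) fun i hi => by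
    rw [Module.Basis.coord_apply, Finsupp.notMem_support_iff.1 hi, zero_smul, zero_mul]]
  refine Finset.sum_congr rfl fun i _ => ?_
  rw [Module.Basis.coord_apply, map_smul, smul_mul_assoc, smul_mul_assoc, mul_comm]

variable [Finite Fq]

theorem tendsto_coord_smul (hu : Filter.Tendsto u Filter.cofinite (nhds 0)) :
    Filter.Tendsto (fun x : ι × κ => b.coord x.1 (v x.2) • u x.2) Filter.cofinite (nhds 0) := by
  have := Fintype.ofFinite Fq
  rw [Metric.tendsto_nhds]
  intro ε hε
  obtain ⟨S, hS⟩ := exists_forall_notMem_norm_le hu (half_pos hε)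
  rw [Filter.eventually_cofinite]
  refine (S.finite_toSet.biUnion fun k _ =>
    (b.repr (v k)).support.finite_toSet.image fun i => (i, k)).subset ?_
  rintro ⟨i, k⟩ hik
  simp only [Set.mem_ofPred_eq, dist_zero_right, not_lt] at hik
  have hk : k ∈ S := by
    by_contra hk
    have := (norm_smul_le' (b.coord i (v k)) (u k)).trans (hS k hk)
    linarith
  have hi : b.repr (v k) i ≠ 0 := fun h => by
    rw [Module.Basis.coord_apply, h, zero_smul, norm_zero] at hik
    linarith
  exact Set.mem_biUnion hk ⟨i, Finsupp.mem_support_iff.2 hi, rfl⟩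

theorem tsum_tsum_coord_smul_mul_eq [CompleteSpace C] [IsUltrametricDist C]
    (hu : Filter.Tendsto u Filter.cofinite (nhds 0)) (G : L →ₗ[Fq] C) {B : ℝ}
    (hB : ∀ l, ‖G l‖ ≤ B) :
    ∑' i, (∑' k, b.coord i (v k) • u k) * G (b i) = ∑' k, G (v k) * u k := by
  set F : ι → κ → C := fun i k => b.coord i (v k) • u k * G (b i)
  have hsum : Summable (Function.uncurry F) :=
    NonarchimedeanAddGroup.summable_of_tendsto_cofinite_zero
      ((tendsto_coord_smul b v hu).zero_mul_isBoundedUnder_le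
        (Filter.isBoundedUnder_of ⟨B, fun x => hB (b x.1)⟩))
  calc ∑' i, (∑' k, b.coord i (v k) • u k) * G (b i)
      = ∑' i, ∑' k, F i k := tsum_congr fun i => tsum_mul_right.symm
    _ = ∑' k, ∑' i, F i k := (Summable.tsum_comm hsum).symm
    _ = ∑' k, G (v k) * u k := tsum_congr (tsum_coord_smul_mul_eq b v u G)

end Pairing

section EvZeta

variable {Fq A C P : Type*} [Field Fq] [CommRing A] [NormedField C] [Algebra Fq A] [Algebra Fq C]
  [AddCommGroup P] [Module A P] [Module Fq P] [IsScalarTower Fq A P]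

/-- An element of `C ⊗̂ Hom_A(L, P)`, contracted with a functional on `P`: as `w = ∑ d_k ⊗ n_k`, it
is the map `l ↦ ∑ χ(n_k(l)) d_k`. -/
def contract {L : Type*} [AddCommGroup L] [Module A L] [Module Fq L] [IsScalarTower Fq A L]
    (w : CTensor Fq C (L →ₗ[A] P)) (χ : Module.Dual Fq P) : L →ₗ[Fq] C where
  toFun l := w.1 (dualEval l χ)
  map_add' l l' := by
    rw [← map_add]
    congr 1
    ext n
    simp [dualEval]
  map_smul' k l := by
    rw [RingHom.id_apply, ← map_smul]
    congr 1
    ext n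
    simp [dualEval]

variable [Fintype Fq] [Algebra A C] [IsScalarTower Fq A C] [CompleteSpace C] [IsUltrametricDist C]
  {Λ : Submodule A C}

theorem ev_universalZeta_apply (hΛ : IsLocallyFinite Λ) (w : CTensor Fq C (Λ →ₗ[A] P))
    (χ : Module.Dual Fq P) :
    (ev (universalZeta Fq Λ hΛ) w).1 χ =
      -∑' l : {l : Λ // l ≠ 0}, w.1 (dualEval l.1 χ) * (l.1 : C)⁻¹ := by
  obtain ⟨B, -, hB⟩ := CTensor.exists_bound w
  have hsum := tsum_tsum_coord_smul_mul_eq (Module.Basis.ofVectorSpace Fq Λ)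
    (fun l : {l : Λ // l ≠ 0} => l.1) (tendsto_inv_lattice hΛ) (contract w χ)
    fun l => hB (dualEval l χ)
  refine Eq.trans ?_ (congrArg Neg.neg hsum)
  rw [← tsum_neg]
  exact tsum_congr fun i => neg_mul _ _

theorem ev_zero_right (z : CTensor Fq C Λ) : ev z (0 : CTensor Fq C (Λ →ₗ[A] P)) = 0 :=
  Subtype.ext (LinearMap.ext fun χ => by simp [ev])

end EvZeta

section Residues

variable {Fq A K C : Type*} [Field Fq] [CommRing A] [Field K] [NormedField C] [Algebra Fq A]
  [Algebra Fq K] [Algebra A K] [Algebra K C] [IsScalarTower Fq A K]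

theorem ker_map_le_torsion (Fq A K : Type*) [CommRing Fq] [CommRing A] [CommRing K] [Algebra Fq A]
    [Algebra Fq K] [Algebra A K] [IsScalarTower Fq A K] [IsFractionRing A K] :
    LinearMap.ker (KaehlerDifferential.map Fq Fq A K) ≤ Submodule.torsion A Ω[A⁄Fq] := by
  intro η hη
  have := KaehlerDifferential.isLocalizedModule_map Fq A K (nonZeroDivisors A)
  exact (IsLocalizedModule.eq_zero_iff (nonZeroDivisors A) _).1 hη

variable {O : ValuationSubring K} {π : K}

theorem exists_forall_map_eq_smul_D [Fintype Fq] [CompleteSpace C]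
    (hA : IsRingOfFunctionsAwayFrom Fq A O) (hC : IsCInfty Fq C O)
    (hπ : ‖algebraMap K C π‖ = (Fintype.card Fq : ℝ)⁻¹) :
    ∃ g : Ω[A⁄Fq] →ₗ[A] K, ∀ η,
      KaehlerDifferential.map Fq Fq A K η = g η • KaehlerDifferential.D Fq K π := by
  obtain ⟨s, hs⟩ := LinearMap.exists_rightInverse_of_surjective
    (LinearMap.toSpanSingleton K Ω[K⁄Fq] (KaehlerDifferential.D Fq K π)) (by
      rw [LinearMap.range_toSpanSingleton, span_D_uniformizer_eq_top hA hC hπ])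
  exact ⟨s.restrictScalars A ∘ₗ KaehlerDifferential.map Fq Fq A K,
    fun η => (LinearMap.congr_fun hs _).symm⟩

variable [Algebra Fq C]

theorem IsResidue.of_smul [Algebra A C] [IsScalarTower A K C] {b : C} {a : A}
    (ha : algebraMap A K a ≠ 0) {η : Ω[A⁄Fq]} {x : Fq} (h : IsResidue π b (a • η) x) :
    IsResidue π (algebraMap A C a * b) η x := by
  obtain ⟨k, hk, hres⟩ := h
  refine ⟨(algebraMap A K a)⁻¹ * k, ?_, ?_⟩
  · rw [mul_smul, ← hk, map_smul, ← algebraMap_smul K a, inv_smul_smul₀ ha]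
  · have haC : algebraMap K C (algebraMap A K a) ≠ 0 := by simpa using ha
    rwa [IsScalarTower.algebraMap_apply A K C, map_mul, map_inv₀, mul_comm _ b, mul_assoc,
      mul_inv_cancel_left₀ haC]

theorem universalOmega_eq_zero_or_isExponential [Algebra A C] (π : K) (Λ : Submodule A C) :
    universalOmega Fq π Λ = 0 ∨ IsExponential Fq π Λ (universalOmega Fq π Λ) := by
  by_cases hw : ∃ w, IsExponential Fq π Λ w
  · rw [universalOmega, dif_pos hw]
    exact Or.inr hw.choose_spec
  · rw [universalOmega, dif_neg hw]
    exact Or.inl rfl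

variable [Fintype Fq] [CompleteSpace C] [IsUltrametricDist C] [Algebra A C] [IsScalarTower Fq A C]
  [IsScalarTower A K C] [IsFractionRing A K]

theorem exists_finset_forall_isResidue (hA : IsRingOfFunctionsAwayFrom Fq A O)
    (hC : IsCInfty Fq C O) (hπ : ‖algebraMap K C π‖ = (Fintype.card Fq : ℝ)⁻¹) {ε : ℝ}
    (hε : 0 < ε) :
    ∃ S : Finset Ω[A⁄Fq], ∀ χ : Module.Dual Fq Ω[A⁄Fq], (∀ η ∈ S, χ η = 0) →
      ∃ b ∈ kInfty K C, ‖b‖ < ε ∧ ∀ η, IsResidue π b η (χ η) := by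
  have htower : IsScalarTower Fq K C := IsScalarTower.to₁₃₄ Fq A K C
  have hft := finiteType hA hC
  obtain ⟨g, hg⟩ := exists_forall_map_eq_smul_D hA hC hπ
  have hker : LinearMap.ker g ≤ Submodule.torsion A Ω[A⁄Fq] := fun η hη =>
    ker_map_le_torsion Fq A K (LinearMap.mem_ker.2 (by rw [hg, LinearMap.mem_ker.1 hη, zero_smul]))
  obtain ⟨N, hN⟩ := pow_unbounded_of_one_lt ε⁻¹ (one_lt_card Fq)
  have hfin := finite_norm_le_of_ker_le_torsion hA hC hker ((Fintype.card Fq : ℝ) ^ N)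
  refine ⟨hfin.toFinset, fun χ hχ => ?_⟩
  obtain ⟨b, hb, hbN, hbχ⟩ := exists_forall_hasResidue_mul hA hC (algebraMap_mem_kInfty π) hπ
    (g := (IsScalarTower.toAlgHom Fq K C).toLinearMap ∘ₗ g.restrictScalars Fq)
    (fun η => algebraMap_mem_kInfty (g η)) χ N fun η hη => hχ η (hfin.mem_toFinset.2 hη)
  refine ⟨b, hb, hbN.trans_lt ?_, fun η => ⟨g η, hg η, hbχ η⟩⟩
  rw [zpow_neg, zpow_natCast]
  exact inv_lt_of_inv_lt₀ hε hN

end Residues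

section Main

variable {Fq A K C : Type*} [Field Fq] [Fintype Fq] [CommRing A] [Field K] [NormedField C]
  [CompleteSpace C] [IsUltrametricDist C] [Algebra Fq A] [Algebra Fq K] [Algebra Fq C]
  [Algebra A K] [Algebra A C] [Algebra K C] [IsScalarTower Fq A K] [IsScalarTower Fq A C]
  [IsScalarTower A K C] [IsFractionRing A K] {O : ValuationSubring K} {π : K}
  {Λ : Submodule A C} {w : CTensor Fq C (Λ →ₗ[A] Ω[A⁄Fq])}

theorem exists_forall_ev_twist_apply_eq (hA : IsRingOfFunctionsAwayFrom Fq A O)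
    (hC : IsCInfty Fq C O) (hΛ : IsLocallyFinite Λ) (h0 : Λ ≠ ⊥) (hw : IsExponential Fq π Λ w)
    (j : ℕ) :
    ∃ ε > 0, ∀ b ∈ kInfty K C, ‖b‖ < ε → ∀ χ : Module.Dual Fq Ω[A⁄Fq],
      (∀ η, IsResidue π b η (χ η)) →
      (ev (universalZeta Fq Λ hΛ) (twist j w)).1 χ = if j = 0 then b else 0 := by
  obtain ⟨t, ht⟩ := exists_one_lt_norm hA hC
  obtain ⟨ε, hε, hsum⟩ := exists_forall_tsum_latticeExp_eq Fq hΛ h0 ht j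
  obtain ⟨B, -, hB⟩ := CTensor.exists_bound w
  refine ⟨ε, hε, fun b hb hbε χ hχ => ?_⟩
  have hexp : ∀ l : Λ, w.1 (dualEval l χ) = latticeExp Λ (b * l) := fun l =>
    hw b hb l _ fun n => hχ (n l)
  rw [ev_universalZeta_apply]
  simp only [twist_apply, hexp]
  rw [hsum b hbε B fun l hl => hexp ⟨l, hl⟩ ▸ hB _, neg_neg]

theorem ev_twist_mem_range_ofTensor (hA : IsRingOfFunctionsAwayFrom Fq A O)
    (hC : IsCInfty Fq C O) (hπ : ‖algebraMap K C π‖ = (Fintype.card Fq : ℝ)⁻¹)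
    (hΛ : IsLocallyFinite Λ) (h0 : Λ ≠ ⊥) (hw : IsExponential Fq π Λ w) {j : ℕ} (hj : j ≠ 0) :
    ev (universalZeta Fq Λ hΛ) (twist j w) ∈ LinearMap.range (ofTensor Fq C Ω[A⁄Fq]) := by
  obtain ⟨ε, hε, hev⟩ := exists_forall_ev_twist_apply_eq hA hC hΛ h0 hw j
  obtain ⟨S, hS⟩ := exists_finset_forall_isResidue (C := C) hA hC hπ hε
  refine (mem_range_ofTensor_iff _).2 ⟨S, fun χ hχ => ?_⟩
  obtain ⟨b, hb, hbε, hbχ⟩ := hS χ hχ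
  rw [hev b hb hbε χ hbχ, if_neg hj]

theorem diagonal_ev_mem_range_ofTensor (hA : IsRingOfFunctionsAwayFrom Fq A O)
    (hC : IsCInfty Fq C O) (hπ : ‖algebraMap K C π‖ = (Fintype.card Fq : ℝ)⁻¹)
    (hΛ : IsLocallyFinite Λ) (h0 : Λ ≠ ⊥) (hw : IsExponential Fq π Λ w) (a : A) :
    tensorAction Fq C Ω[A⁄Fq] A (algebraMap A C a ⊗ₜ[Fq] (1 : A) - (1 : C) ⊗ₜ[Fq] a)
      (ev (universalZeta Fq Λ hΛ) w) ∈ LinearMap.range (ofTensor Fq C Ω[A⁄Fq]) := by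
  rcases eq_or_ne a 0 with rfl | ha
  · rw [map_zero, TensorProduct.zero_tmul, TensorProduct.tmul_zero, sub_zero, zero_tensorAction]
    exact zero_mem _
  obtain ⟨ε, hε, hev⟩ := exists_forall_ev_twist_apply_eq hA hC hΛ h0 hw 0
  simp only [twist_zero_left, if_pos] at hev
  set α := algebraMap A C a
  obtain ⟨S, hS⟩ := exists_finset_forall_isResidue (C := C) hA hC hπ
    (show 0 < ε / (‖α‖ + 1) by positivity)
  refine (mem_range_ofTensor_iff _).2 ⟨S, fun χ hχ => ?_⟩
  obtain ⟨b, hb, hbε, hbχ⟩ := hS χ hχ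
  rw [lt_div_iff₀ (by positivity), mul_add, mul_one] at hbε
  have hb_lt : ‖b‖ < ε := (le_add_of_nonneg_left (by positivity)).trans_lt hbε
  have hαb_lt : ‖α * b‖ < ε := by
    rw [norm_mul, mul_comm]
    exact (le_add_of_nonneg_right (norm_nonneg b)).trans_lt hbε
  have hαb : α * b ∈ kInfty K C := mul_mem (algebraMap_mem_kInfty_of_isScalarTower a) hb
  have ha' : algebraMap A K a ≠ 0 := by simpa using ha
  rw [tensorAction_diagonal_apply, hev b hb hb_lt χ hbχ,
    hev (α * b) hαb hαb_lt _ fun η => (hbχ (a • η)).of_smul ha', sub_self]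

theorem IsPeriodLattice.ne_bot {Fq A C : Type*} [Field Fq] [CommRing A] [Nontrivial A]
    [NormedField C] [Algebra Fq C] [Algebra A C] {φ : A →+* Module.End Fq C} {r : ℕ}
    {Λ : Submodule A C} (hΛ : IsPeriodLattice φ r Λ) (hr : 0 < r) : Λ ≠ ⊥ := by
  rintro rfl
  have hrank := hΛ.finrank_eq
  rw [Module.finrank_zero_of_subsingleton] at hrank
  exact hr.ne hrank

end Main

theorem mainTheorem1_general {Fq A K C : Type*} [Field Fq] [Fintype Fq] [CommRing A] [Field K]
    [NormedField C] [CompleteSpace C] [IsUltrametricDist C] [Algebra Fq A] [Algebra Fq K]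
    [Algebra Fq C] [Algebra A K] [Algebra A C] [Algebra K C] [IsScalarTower Fq A K]
    [IsScalarTower Fq A C] [IsScalarTower A K C] [IsFractionRing A K] {O : ValuationSubring K}
    (hA : IsRingOfFunctionsAwayFrom Fq A O) (hC : IsCInfty Fq C O) {π : K}
    (hπ : ‖algebraMap K C π‖ = (Fintype.card Fq : ℝ)⁻¹) {Λ : Submodule A C}
    (hΛ : IsLocallyFinite Λ) (h0 : Λ ≠ ⊥) :
    (∀ j, IsRational A (ev (universalZeta Fq Λ hΛ) (twist j (universalOmega Fq π Λ)))) ∧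
    (∀ h ∈ diagonalIdeal Fq C A,
      tensorAction Fq C Ω[A⁄Fq] A h (ev (universalZeta Fq Λ hΛ) (universalOmega Fq π Λ)) ∈
        LinearMap.range (ofTensor Fq C Ω[A⁄Fq])) ∧
    (∀ j, 1 ≤ j → ∀ h : C ⊗[Fq] A,
      tensorAction Fq C Ω[A⁄Fq] A h
          (ev (universalZeta Fq Λ hΛ) (twist j (universalOmega Fq π Λ))) ∈
        LinearMap.range (ofTensor Fq C Ω[A⁄Fq])) := by
  rcases universalOmega_eq_zero_or_isExponential (Fq := Fq) π Λ with hw | hw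
  · simp only [hw, twist_zero_right, ev_zero_right, tensorAction_zero, zero_mem, implies_true,
      and_true]
    exact fun _ => ⟨1, one_mem _, by simp only [tensorAction_zero, zero_mem]⟩
  have hdiag := diagonal_ev_mem_range_ofTensor hA hC hπ hΛ h0 hw
  have htwist : ∀ j, 1 ≤ j → ∀ h : C ⊗[Fq] A, _ := fun j hj h =>
    tensorAction_mem_range_ofTensor h
      (ev_twist_mem_range_ofTensor hA hC hπ hΛ h0 hw (Nat.one_le_iff_ne_zero.1 hj))
  refine ⟨fun j => ?_, fun h hh => tensorAction_mem_range_of_mem_diagonalIdeal hdiag hh, htwist⟩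
  rcases Nat.eq_zero_or_pos j with rfl | hj
  · obtain ⟨t, ht⟩ := exists_one_lt_norm (K := K) hA hC
    rw [twist_zero_left]
    exact ⟨_, diagonal_mem_nonZeroDivisors (K := K) hA hC ht, hdiag t⟩
  · exact ⟨1, one_mem _, htwist j hj 1⟩

end DrinfeldPairing

open DrinfeldPairing in
theorem mainTheorem1 {Fq A K C : Type*} [Field Fq] [Fintype Fq] [CommRing A] [IsDomain A]
    [Field K] [NormedField C] [CompleteSpace C] [IsUltrametricDist C]
    [Algebra Fq A] [Algebra Fq K] [Algebra Fq C] [Algebra A K] [Algebra A C] [Algebra K C]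
    [IsScalarTower Fq A K] [IsScalarTower Fq A C] [IsScalarTower A K C] [IsFractionRing A K]
    (O : ValuationSubring K) (hA : IsRingOfFunctionsAwayFrom Fq A O) (hC : IsCInfty Fq C O)
    (π : K) (hπ : ‖algebraMap K C π‖ = (Fintype.card Fq : ℝ)⁻¹)
    (r : ℕ) (hr : 0 < r) (φ : A →+* Module.End Fq C) (hφ : IsDrinfeldModule φ r)
    (Λ : Submodule A C) (hΛ : IsPeriodLattice φ r Λ) :
    (∀ j < r, IsRational A (ev (universalZeta Fq Λ hΛ.locallyFinite) (twist j (universalOmega Fq π Λ)))) ∧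
    (∀ h ∈ diagonalIdeal Fq C A,
      tensorAction Fq C Ω[A⁄Fq] A h (ev (universalZeta Fq Λ hΛ.locallyFinite) (universalOmega Fq π Λ)) ∈
        LinearMap.range (ofTensor Fq C Ω[A⁄Fq])) ∧
    (∀ j, 1 ≤ j → j < r → ∀ h : C ⊗[Fq] A,
      tensorAction Fq C Ω[A⁄Fq] A h
          (ev (universalZeta Fq Λ hΛ.locallyFinite) (twist j (universalOmega Fq π Λ))) ∈
        LinearMap.range (ofTensor Fq C Ω[A⁄Fq])) := by
  obtain ⟨hrational, hdiag, htwist⟩ := mainTheorem1_general hA hC hπ hΛ.locallyFinite (hΛ.ne_bot hr)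
  exact ⟨fun j _ => hrational j, hdiag, fun j hj _ => htwist j hj⟩
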